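/- **Setting.** Let $m,n,d\ge 1$. For $1\le i\le m$, $1\le j\le n$ let $f_{i,j}:\mathbb R^d\to\mathbb R$ be convex and $L_{i,j}$-smooth (differentiable with $L_{i,j}$-Lipschitz gradient), and let $f_i=\frac1n\sum_{j}f_{i,j}$ be $L_i$-smooth and $\mu$-strongly convex, $\mu>0$. Put $L_f=\max_iL_i$, $\overline L_i=\frac1n\sum_jL_{i,j}$, $\overline L_f=\max_i\overline L_i$, $\kappa_b=L_f/\mu$, $\kappa_s=\overline L_f/\mu$, and assume $L_f\le\overline L_f$ (automatic for the smallest constants $L_i$, since $f_i$ is always $\overline L_i$-smooth). Let $x^*$ minimize $\sum_if_i$ over $\mathbb R^d$ and let $\mathbf x^*\in\mathbb R^{m\times d}$ have all rows equal to $x^*$. Rows of $\mathbf x\in\mathbb R^{m\times d}$ are written $x_i$, and $\|\cdot\|$ is the Frobenius norm. Let $U,V\in\mathbb R^{m\times m}$ be symmetric with $U\mathbf x=0\Leftrightarrow x_1=\dots=x_m\Leftrightarrow V\mathbf x=0$, and let $\kappa\ge1$ be such that $$\|U\mathbf x\|^2\le\|V\mathbf x\|^2,\qquad \|V\mathbf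 x\|^2\le\tfrac12\|\mathbf x\|^2,\qquad \|U\boldsymbol\lambda\|^2\ge\tfrac1\kappa\|\boldsymbol\lambda\|^2\ \text{ for all }\boldsymbol\lambda\text{ of the form }\boldsymbol\lambda=U\mathbf x .$$ **Method.** Let $$b=\left\lceil\sqrt{\frac{n\max\{\overline L_f,n\mu\}}{\kappa L_f}}\,\right\rceil,\quad \theta_1=\frac12\sqrt{\frac{\kappa\mu}{L_f}},\quad \theta_2=\frac{\overline L_f}{2L_fb},\quad \alpha=\frac1{10L_f},\quad p_{i,j}=\frac{L_{i,j}}{\sum_{j'}L_{i,j'}} .$$ Start from $\mathbf x^0=\mathbf z^0=\mathbf w^0$ arbitrary and $\boldsymbol\lambda^0=0$. For $k=0,1,2,\dots$ each node $i$ draws a mini-batch $S_i^k$ of $b$ independent samples, with replacement, from the distribution $(p_{i,j})_j$, and sets $$\begin{aligned} y_i^k&=\theta_1z_i^k+\theta_2w_i^k+(1-\theta_1-\theta_2)x_i^k,\\ \nabla_i^k&=\frac1b\sum_{j\in S_i^k}\frac1{np_{i,j}}\left(\nabla f_{i,j}(y_i^k)-\nabla f_{i,j}(w_i^k)\right)+\nabla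 f_i(w_i^k),\\ z_i^{k+1}&=\frac1{1+\frac{\mu\alpha}{\theta_1}}\left(\frac{\mu\alpha}{\theta_1}y_i^k+z_i^k-\frac1{\theta_1}\left(\alpha\nabla_i^k+(U\boldsymbol\lambda^k)_i+\theta_1(V^2\mathbf z^k)_i\right)\right),\\ \lambda_i^{k+1}&=\lambda_i^k+\theta_1(U\mathbf z^{k+1})_i,\qquad x_i^{k+1}=y_i^k+\theta_1(z_i^{k+1}-z_i^k),\\ w_i^{k+1}&=x_i^{k+1}\text{ with probability }\tfrac bn,\qquad w_i^{k+1}=w_i^k\text{ with probability }1-\tfrac bn, \end{aligned}$$ all random choices (over nodes, samples, snapshot updates and iterations) being independent. **Cost.** One iteration costs one communication round. Node $i$ evaluates $n$ component gradients at the start (for $\nabla f_i(w_i^0)$), $2b$ in each iteration (each sampled component at $y_i^k$ and at $w_i^k$), and $n$ more in each iteration in which its snapshot is set to $x_i^{k+1}$. **Theorem.** There is an absolute constant $C>0$ such that, for every problem and initial point as above, there is $\epsilon_0>0$ (depending on the $f_{i,j}$, $L_i$, $L_{i,j}$, $\mu$ and the initial point, but not on $U,V,\kappa$) with the following property. If $$\kappa\le\kappa_b\qquad\text{and}\qquad\kappa\le\max\left\{\frac{n\kappa_b}{\kappa_s},\frac{n^2\kappa_b}{\kappa_s^2}\right\},$$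 then for every $0<\epsilon\le\epsilon_0$ there is a number $K$ of iterations such that $\mathbb E\|\mathbf z^k-\mathbf x^*\|^2\le\epsilon$ for all $k\ge K$, and the first $K$ iterations take at most $C\sqrt{\kappa_b\kappa}\,\log\frac1\epsilon$ communication rounds and, at each node, in expectation at most $C(\sqrt{n\kappa_s}+n)\log\frac1\epsilon$ evaluations of component gradients. -/

import Mathlib

noncomputable section

namespace DecentralizedVR

open MeasureTheory ProbabilityTheory

/-- The space `ℝᵈ` with the Euclidean norm. -/
abbrev Vec (d : ℕ) := EuclideanSpace ℝ (Fin d)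

/-- An `m × d` matrix, seen as the stack of the local variables (its rows) of the `m` nodes. -/
abbrev Stacked (m d : ℕ) := Fin m → Vec d

/-- The squared Frobenius norm of a stacked variable. -/
def sqNorm {m d : ℕ} (x : Stacked m d) : ℝ := ∑ i, ‖x i‖ ^ 2

/-- The matrix product `A x` of an `m × m` matrix with a stacked variable. -/
def mix {m d : ℕ} (A : Matrix (Fin m) (Fin m) ℝ) (x : Stacked m d) : Stacked m d :=
  fun i => ∑ j, A i j • x j

/-- `g` is `L`-smooth: differentiable, with an `L`-Lipschitz gradient. -/
def LSmooth {d : ℕ} (L : ℝ) (g : Vec d → ℝ) : Prop :=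
  Differentiable ℝ g ∧ ∀ x y, ‖gradient g y - gradient g x‖ ≤ L * ‖y - x‖

/-- The data of the problem `min_x ∑ᵢ fᵢ(x)`, `fᵢ = (1/n) ∑ⱼ fᵢⱼ`, with `m` nodes and `n` samples
per node: the components `fᵢⱼ`, a constant `Lᵢ` for each `fᵢ`, a constant `Lᵢⱼ` for each `fᵢⱼ`,
and `μ`. -/
structure Problem (m n d : ℕ) where
  f : Fin m → Fin n → Vec d → ℝ
  L : Fin m → ℝ
  Lc : Fin m → Fin n → ℝ
  μ : ℝ

namespace Problem

variable {m n d : ℕ} (D : Problem m n d)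

/-- The local objective `fᵢ`. -/
def localObj (i : Fin m) (x : Vec d) : ℝ := (1 / (n : ℝ)) * ∑ j, D.f i j x

/-- The global objective `x ↦ ∑ᵢ fᵢ(x)`. -/
def objective (x : Vec d) : ℝ := ∑ i, D.localObj i x

/-- `L_f = maxᵢ Lᵢ`. -/
def Lf : ℝ := ⨆ i, D.L i

/-- `L̄ᵢ = (1/n) ∑ⱼ Lᵢⱼ`. -/
def Lbar (i : Fin m) : ℝ := (1 / (n : ℝ)) * ∑ j, D.Lc i j

/-- `L̄_f = maxᵢ L̄ᵢ`. -/
def Lbarf : ℝ := ⨆ i, D.Lbar i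

/-- The batch condition number `κ_b = L_f / μ`. -/
def kappaB : ℝ := D.Lf / D.μ

/-- The stochastic condition number `κ_s = L̄_f / μ`. -/
def kappaS : ℝ := D.Lbarf / D.μ

/-- Each `fᵢ` is `Lᵢ`-smooth and `μ`-strongly convex (`μ > 0`), each `fᵢⱼ` is `Lᵢⱼ`-smooth and
convex. -/
structure Regular : Prop where
  mu_pos : 0 < D.μ
  local_smooth : ∀ i, LSmooth (D.L i) (D.localObj i)
  local_strongConvex : ∀ i, StrongConvexOn Set.univ D.μ (D.localObj i)
  comp_smooth : ∀ i j, LSmooth (D.Lc i j) (D.f i j)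
  comp_convex : ∀ i j, ConvexOn ℝ Set.univ (D.f i j)

/-- The sampling probability `pᵢⱼ = Lᵢⱼ / ∑ⱼ' Lᵢⱼ'`. -/
def prob (i : Fin m) (j : Fin n) : ℝ := D.Lc i j / ∑ j', D.Lc i j'

end Problem

/-- The conditions on the symmetric matrices `U`, `V` and the number `κ`: both kernels are the
consensus subspace, `‖U x‖² ≤ ‖V x‖²`, `‖V x‖² ≤ ‖x‖² / 2`, and `‖U λ‖² ≥ ‖λ‖² / κ` for every
`λ` whose columns lie in the range of `U`. -/
structure MixingPair {m : ℕ} (d : ℕ) (U V : Matrix (Fin m) (Fin m) ℝ) (κ : ℝ) : Prop where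
  U_symm : U.IsSymm
  V_symm : V.IsSymm
  U_ker : ∀ x : Stacked m d, mix U x = 0 ↔ ∀ i j, x i = x j
  V_ker : ∀ x : Stacked m d, mix V x = 0 ↔ ∀ i j, x i = x j
  U_le_V : ∀ x : Stacked m d, sqNorm (mix U x) ≤ sqNorm (mix V x)
  V_le : ∀ x : Stacked m d, sqNorm (mix V x) ≤ (1 / 2) * sqNorm x
  U_ge : ∀ l : Stacked m d, (∃ x : Stacked m d, l = mix U x) →
    (1 / κ) * sqNorm l ≤ sqNorm (mix U l)

/-- The parameters of the method: step size `α`, momentum parameters, mini-batch size `b`. -/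
structure Params where
  α : ℝ
  θ₁ : ℝ
  θ₂ : ℝ
  b : ℕ

/-- The mini-batch size `√(n max{L̄_f, n μ} / (κ L_f))`, rounded up to an integer. -/
def batchSize {m n d : ℕ} (D : Problem m n d) (κ : ℝ) : ℕ :=
  ⌈Real.sqrt (n * max D.Lbarf (n * D.μ) / (κ * D.Lf))⌉₊

/-- `α = 1/(10 L_f)`, `θ₁ = √(κ μ / L_f) / 2`, `θ₂ = L̄_f / (2 L_f b)`, with `b` as above. -/
def accParams {m n d : ℕ} (D : Problem m n d) (κ : ℝ) : Params where
  α := 1 / (10 * D.Lf)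
  θ₁ := (1 / 2) * Real.sqrt (κ * D.μ / D.Lf)
  θ₂ := D.Lbarf / (2 * D.Lf * (batchSize D κ : ℝ))
  b := batchSize D κ

/-- The randomness of one iteration: for every node, a mini-batch of `b` sample indices (with
replacement) and a coin that decides whether the snapshot is refreshed. -/
abbrev Noise (m n b : ℕ) := Fin m → (Fin b → Fin n) × Bool

/-- The probability of an outcome of one iteration: all the samples and coins are independent, node
`i` draws sample `j` with probability `pᵢⱼ`, and its coin is `true` with probability `b / n`. -/
def noiseWeight {m n d : ℕ} (D : Problem m n d) (b : ℕ) (s : Noise m n b) : ℝ :=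
  ∏ i, (∏ l, D.prob i ((s i).1 l)) * (if (s i).2 then (b : ℝ) / n else 1 - (b : ℝ) / n)

/-- `ξ 0, ξ 1, …` are independent and each of them has the law `noiseWeight`. -/
structure IsSampling {m n d b : ℕ} (D : Problem m n d) {Ω : Type*} [MeasurableSpace Ω]
    (P : Measure Ω) (ξ : ℕ → Ω → Noise m n b) : Prop where
  measurable : ∀ k, Measurable (ξ k)
  indep : iIndepFun ξ P
  law : ∀ k s, P.real {ω | ξ k ω = s} = noiseWeight D b s

/-- The iterates `x, z, w, λ` of the method, together with the number `comm` of communication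
rounds so far and the number `evals i` of component gradients `∇fᵢⱼ` evaluated so far by node
`i`. -/
structure State (m d : ℕ) where
  x : Stacked m d
  z : Stacked m d
  w : Stacked m d
  lam : Stacked m d
  comm : ℕ
  evals : Fin m → ℕ

/-- The mini-batch variance reduced estimator
`(1/b) ∑_{j ∈ S} (∇fᵢⱼ(y) - ∇fᵢⱼ(w)) / (n pᵢⱼ) + ∇fᵢ(w)` of node `i`. -/
def vrGradient {m n d b : ℕ} (D : Problem m n d) (i : Fin m) (S : Fin b → Fin n)
    (y w : Vec d) : Vec d :=
  (1 / (b : ℝ)) • ∑ l, (1 / ((n : ℝ) * D.prob i (S l))) •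
      (gradient (D.f i (S l)) y - gradient (D.f i (S l)) w)
    + gradient (D.localObj i) w

/-- One iteration. It costs one communication round; node `i` evaluates `2 b` component
gradients for its estimator (each sampled component at `y` and at `w`), and `n` more when it
refreshes its snapshot, for the new full local gradient. -/
def step {m n d : ℕ} (D : Problem m n d) (U V : Matrix (Fin m) (Fin m) ℝ) (p : Params)
    (s : State m d) (ξ : Noise m n p.b) : State m d :=
  let y : Stacked m d := fun i =>
    p.θ₁ • s.z i + p.θ₂ • s.w i + (1 - p.θ₁ - p.θ₂) • s.x i
  let g : Stacked m d := fun i => vrGradient D i (ξ i).1 (y i) (s.w i)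
  let z' : Stacked m d := fun i =>
    (1 / (1 + D.μ * p.α / p.θ₁)) • ((D.μ * p.α / p.θ₁) • y i + s.z i
      - (1 / p.θ₁) • (p.α • g i + mix U s.lam i + p.θ₁ • mix (V * V) s.z i))
  let x' : Stacked m d := fun i => y i + p.θ₁ • (z' i - s.z i)
  { x := x'
    z := z'
    w := fun i => if (ξ i).2 then x' i else s.w i
    lam := fun i => s.lam i + p.θ₁ • mix U z' i
    comm := s.comm + 1
    evals := fun i => s.evals i + 2 * p.b + (if (ξ i).2 then n else 0) }

/-- Initialization `x = z = w = x₀`, `λ = 0`; each node evaluates its full local gradient at its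
first snapshot, which costs `n` component gradients. -/
def initState {m d : ℕ} (n : ℕ) (x₀ : Stacked m d) : State m d where
  x := x₀
  z := x₀
  w := x₀
  lam := 0
  comm := 0
  evals := fun _ => n

/-- The state of the method after `k` iterations, along a realization `ξ` of the randomness. -/
def run {m n d : ℕ} (D : Problem m n d) (U V : Matrix (Fin m) (Fin m) ℝ) (p : Params)
    (x₀ : Stacked m d) (ξ : ℕ → Noise m n p.b) : ℕ → State m d
  | 0 => initState n x₀
  | k + 1 => step D U V p (run D U V p x₀ ξ k) (ξ k)

end DecentralizedVR

end

/-! The method is an accelerated, variance-reduced primal-dual scheme for minimizing `∑ fᵢ(xᵢ)`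
under the consensus constraint `U x = 0`. The gradients at the minimizer sum to zero, hence lie in
the range of `U`, which gives a dual solution `λ* = U us` with `∇fᵢ(x*) = -10 L_f (U λ*)ᵢ`
(`exists_dual`). The function `lyap` combines Bregman divergences to `x*` at the `x` and `w`
iterates with `‖z - x*‖²` and `‖λ - λ*‖²`. Everything rests on its contraction by `1 - ρ` in
conditional expectation (`expNoise_lyap_step_le`), with `ρ = θ₁ / (30 κ)`.

The deterministic half is `one_step_le`: a three-point inequality for `z`, the descent lemma from
`y` to `x'`, and strong convexity at `y`. Squaring the multiplier update produces `θ₁² ‖U z'‖²`,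
which the explicit `V²` term absorbs because `‖U x‖² ≤ ‖V x‖² ≤ ‖x‖² / 2`. The multiplier contracts
although the dual has no explicit strong concavity: `λ - λ*` lies in the range of `U`, so its norm
is at most `√κ ‖U (λ - λ*)‖`, and the optimality condition for `z'` writes `U (λ - λ*)` in terms of
primal errors, paid for by leftover slack (`dual_error_le`, `dual_coeff_le`).

The stochastic half bounds the variance of the estimator by `2 L̄_f / b` times the Bregman
divergence between `w` and `y`; importance sampling is what makes the mean constant `L̄ᵢ` appear.
The value of `θ₂` makes this cancel exactly against the negative Bregman term created by the
momentum towards `w`.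

It remains to check the parameters. The restriction on `κ` gives `θ₂ ≤ 1/2` and `b ≤ n`. Then `1/ρ =
60 √(κ_b κ)` counts the rounds, and the expected cost `3 b` per iteration turns this into `√(n κ_s)
+ n` gradient evaluations, up to a constant and the logarithm. -/

noncomputable section

namespace DecentralizedVR

open MeasureTheory ProbabilityTheory

/-! ### Inequalities for smooth and strongly convex functions -/

section Convex

variable {E : Type*} [NormedAddCommGroup E] [InnerProductSpace ℝ E]

/-- Cocoercivity of the gradient, for a function squeezed between its tangents and paraboloids. -/
lemma sq_norm_gradient_sub_le {φ : E → ℝ} {G : E → E} {M : ℝ} (hM : 0 < M)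
    (h1 : ∀ x y, φ y + inner ℝ (G y) (x - y) ≤ φ x)
    (h2 : ∀ x y, φ x ≤ φ y + inner ℝ (G y) (x - y) + M / 2 * ‖x - y‖ ^ 2) (x y : E) :
    φ y + inner ℝ (G y) (x - y) + 1 / (2 * M) * ‖G x - G y‖ ^ 2 ≤ φ x := by
  set r := G x - G y with hr
  -- A gradient step from `x` on `φ - ⟨G y, ·⟩`, a function that `y` minimizes: its value at `u` is
  -- bounded below by the tangent at `y` and above by the paraboloid at `x`.
  set u := x - (1 / M) • r with hu
  have ha := h1 u y
  have hb := h2 u x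
  have hux : u - x = -((1 / M) • r) := by simp [hu]
  have huy : u - y = (x - y) - (1 / M) • r := by simp only [hu]; abel
  have hG : inner ℝ (G x) r = inner ℝ (G y) r + ‖r‖ ^ 2 := by
    rw [← real_inner_self_eq_norm_sq, ← inner_add_left]; simp [hr]
  rw [hux, inner_neg_right, norm_neg, norm_smul, inner_smul_right, hG, mul_pow,
    Real.norm_eq_abs, sq_abs] at hb
  rw [huy, inner_sub_right, inner_smul_right] at ha
  have hMM : M / 2 * ((1 / M) ^ 2 * ‖r‖ ^ 2) = 1 / (2 * M) * ‖r‖ ^ 2 := by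
    field_simp
  have hMM' : 1 / M * ‖r‖ ^ 2 = 2 * (1 / (2 * M) * ‖r‖ ^ 2) := by
    field_simp
  rw [hMM] at hb
  linarith

variable [CompleteSpace E]

lemma hasDerivAt_comp_line {g : E → ℝ} (hg : Differentiable ℝ g) (x v : E) (t : ℝ) :
    HasDerivAt (fun s : ℝ => g (x + s • v)) (inner ℝ (gradient g (x + t • v)) v) t := by
  have h1 : HasDerivAt (fun s : ℝ => x + s • v) v t := by
    simpa using! ((hasDerivAt_id t).smul_const v).const_add x
  have h2 := (hg (x + t • v)).hasFDerivAt.comp_hasDerivAt t h1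
  rw [inner_gradient_left]
  exact h2

/-- The first order characterization of strong convexity. -/
lemma add_inner_gradient_le_of_strongConvexOn {g : E → ℝ} {μ : ℝ}
    (hc : StrongConvexOn Set.univ μ g) (hg : Differentiable ℝ g) (x y : E) :
    g y + inner ℝ (gradient g y) (x - y) + μ / 2 * ‖x - y‖ ^ 2 ≤ g x := by
  set v := x - y with hv
  have h0 := strongConvexOn_iff_convex.1 hc
  -- On the line from `y` to `x` the secant slope over `[0, 1]` dominates the derivative at `0`; the
  -- subtracted squares recombine into `μ / 2 * ‖x - y‖ ^ 2`.
  have h1 : ConvexOn ℝ Set.univ (fun t : ℝ => g (y + t • v) - μ / 2 * ‖y + t • v‖ ^ 2) := by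
    have := h0.comp_affineMap (AffineMap.lineMap y x)
    simpa [Function.comp_def, AffineMap.lineMap_apply, add_comm, hv] using! this
  have h2 : HasDerivAt (fun t : ℝ => g (y + t • v) - μ / 2 * ‖y + t • v‖ ^ 2)
      (inner ℝ (gradient g y) v - μ / 2 * (2 * inner ℝ y v)) 0 := by
    have ha := hasDerivAt_comp_line hg y v 0
    have hb : HasDerivAt (fun s : ℝ => y + s • v) v 0 := by
      simpa using! ((hasDerivAt_id (0 : ℝ)).smul_const v).const_add y
    have hc := (hb.norm_sq).const_mul (μ / 2)
    simpa using! ha.sub hc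
  have h3 := h1.le_slope_of_hasDerivAt (Set.mem_univ 0) (Set.mem_univ 1) one_pos h2
  have h4 : y + v = x := by simp [hv]
  have h5 : ‖x‖ ^ 2 = ‖y‖ ^ 2 + 2 * inner ℝ y v + ‖v‖ ^ 2 := by
    rw [← h4, norm_add_sq_real]
  simp only [slope_def_field, one_smul, zero_smul, add_zero, h4, sub_zero, div_one] at h3
  rw [h5] at h3
  linarith

/-- The descent lemma for functions with a Lipschitz gradient. -/
lemma le_add_inner_gradient_of_lipschitz {g : E → ℝ} {L : ℝ} (hg : Differentiable ℝ g)
    (hL : ∀ x y, ‖gradient g y - gradient g x‖ ≤ L * ‖y - x‖) (x y : E) :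
    g x ≤ g y + inner ℝ (gradient g y) (x - y) + L / 2 * ‖x - y‖ ^ 2 := by
  set v := x - y with hv
  -- With the linear and quadratic parts removed, the derivative is nonpositive on `(0, 1)` by
  -- Cauchy-Schwarz and the Lipschitz bound; comparing the endpoints gives the claim.
  have hd : ∀ t : ℝ, HasDerivAt
      (fun t : ℝ => g (y + t • v) - t * inner ℝ (gradient g y) v - t ^ 2 * (L / 2 * ‖v‖ ^ 2))
      (inner ℝ (gradient g (y + t • v)) v - 1 * inner ℝ (gradient g y) v
        - (2 * t) * (L / 2 * ‖v‖ ^ 2)) t := by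
    intro t
    refine ((hasDerivAt_comp_line hg y v t).sub ((hasDerivAt_id t).mul_const _)).sub ?_
    simpa using! (hasDerivAt_pow 2 t).mul_const (L / 2 * ‖v‖ ^ 2)
  have hanti : AntitoneOn
      (fun t : ℝ => g (y + t • v) - t * inner ℝ (gradient g y) v - t ^ 2 * (L / 2 * ‖v‖ ^ 2))
      (Set.Icc 0 1) := by
    refine antitoneOn_of_deriv_nonpos (convex_Icc 0 1)
      (fun t _ => (hd t).continuousAt.continuousWithinAt)
      (fun t _ => (hd t).differentiableAt.differentiableWithinAt) ?_
    intro t ht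
    rw [interior_Icc] at ht
    rw [(hd t).deriv, one_mul, ← inner_sub_left]
    have h1 := real_inner_le_norm (gradient g (y + t • v) - gradient g y) v
    have h2 := hL y (y + t • v)
    rw [add_sub_cancel_left, norm_smul, Real.norm_of_nonneg ht.1.le] at h2
    have h3 := mul_le_mul_of_nonneg_right h2 (norm_nonneg v)
    nlinarith
  have h := hanti (Set.left_mem_Icc.2 zero_le_one) (Set.right_mem_Icc.2 zero_le_one) zero_le_one
  have h4 : y + v = x := by simp [hv]
  simp only [one_smul, zero_smul, add_zero, h4] at h
  linarith

/-- The interpolation inequality for smooth and strongly convex functions. -/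
lemma add_sq_norm_gradient_sub_le_of_strongConvexOn {g : E → ℝ} {μ L : ℝ} (hμ : 0 ≤ μ) (hLp : 0 < L)
    (hc : StrongConvexOn Set.univ μ g) (hg : Differentiable ℝ g)
    (hL : ∀ x y, ‖gradient g y - gradient g x‖ ≤ L * ‖y - x‖) (x y : E) :
    g y + inner ℝ (gradient g y) (x - y) + μ / 2 * ‖x - y‖ ^ 2
      + 1 / (2 * L) * ‖gradient g x - gradient g y - μ • (x - y)‖ ^ 2 ≤ g x := by
  have key : ∀ x y : E, ‖x‖ ^ 2 = ‖y‖ ^ 2 + 2 * inner ℝ y (x - y) + ‖x - y‖ ^ 2 := by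
    intro x y
    rw [← norm_add_sq_real]; simp
  -- Cocoercivity applied to `g` minus its quadratic part. The paraboloid constant `L` is kept in
  -- place of `L - μ`, so that `0 < L` is enough.
  have := sq_norm_gradient_sub_le (φ := fun x => g x - μ / 2 * ‖x‖ ^ 2)
    (G := fun x => gradient g x - μ • x) (M := L) hLp
    (by
      intro x y
      have h := add_inner_gradient_le_of_strongConvexOn hc hg x y
      simp only [inner_sub_left, real_inner_smul_left]
      rw [key x y]
      linarith)
    (by
      intro x y
      have h := le_add_inner_gradient_of_lipschitz hg hL x y
      simp only [inner_sub_left, real_inner_smul_left]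
      rw [key x y]
      have : 0 ≤ μ * ‖x - y‖ ^ 2 := by positivity
      linarith) x y
  simp only [inner_sub_left, real_inner_smul_left] at this
  rw [key x y] at this
  have hh : gradient g x - gradient g y - μ • (x - y)
      = gradient g x - μ • x - (gradient g y - μ • y) := by
    rw [smul_sub]; abel
  rw [hh]
  linarith

end Convex

/-! ### The deterministic primal-dual step -/

section OneStep

variable {H : Type*} [NormedAddCommGroup H]

lemma sq_norm_add_five_le (a b c d e : H) :
    ‖a + b + c + d + e‖ ^ 2 ≤ 5 * (‖a‖ ^ 2 + ‖b‖ ^ 2 + ‖c‖ ^ 2 + ‖d‖ ^ 2 + ‖e‖ ^ 2) := by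
  have h : ‖a + b + c + d + e‖ ≤ ‖a‖ + ‖b‖ + ‖c‖ + ‖d‖ + ‖e‖ := by
    refine (norm_add_le _ _).trans (add_le_add_left ?_ _)
    refine (norm_add_le _ _).trans (add_le_add_left ?_ _)
    refine (norm_add_le _ _).trans (add_le_add_left ?_ _)
    exact norm_add_le _ _
  have h2 := pow_le_pow_left₀ (norm_nonneg _) h 2
  nlinarith [sq_nonneg (‖a‖ - ‖b‖), sq_nonneg (‖a‖ - ‖c‖), sq_nonneg (‖a‖ - ‖d‖),
    sq_nonneg (‖a‖ - ‖e‖), sq_nonneg (‖b‖ - ‖c‖), sq_nonneg (‖b‖ - ‖d‖), sq_nonneg (‖b‖ - ‖e‖),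
    sq_nonneg (‖c‖ - ‖d‖), sq_nonneg (‖c‖ - ‖e‖), sq_nonneg (‖d‖ - ‖e‖)]

variable [InnerProductSpace ℝ H]

/-- The contraction available for the multiplier in one primal-dual step. The vectors `a`, `a'`,
`η`, `e` and `h` are the primal errors before and after the step, the dual error, the error of the
gradient estimator and the shifted gradient difference. -/
lemma dual_error_le {U V : H →ₗ[ℝ] H} {L μ θ κ ρ : ℝ} (hL : 0 < L) (hθ : 0 < θ) (hρ : 0 ≤ ρ)
    (hρκ : ρ * κ ≤ θ / 30) (a a' η e h : H)
    (hV2 : ‖V (V a)‖ ^ 2 ≤ 1 / 2 * ‖V a‖ ^ 2) (hη : ‖η‖ ^ 2 ≤ κ * ‖U η‖ ^ 2)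
    (heq : (10 * L) • U η + (e + h + μ • a' + (10 * L * θ) • V (V a)
      + (10 * L * θ) • (a' - a)) = 0) :
    5 * L * ρ * ‖η‖ ^ 2 ≤ θ / (120 * L) * (‖e‖ ^ 2 + ‖h‖ ^ 2 + μ ^ 2 * ‖a'‖ ^ 2
      + 50 * L ^ 2 * θ ^ 2 * ‖V a‖ ^ 2 + 100 * L ^ 2 * θ ^ 2 * ‖a' - a‖ ^ 2) := by
  have h1 : 100 * L ^ 2 * ‖U η‖ ^ 2 = ‖e + h + μ • a' + (10 * L * θ) • V (V a)
      + (10 * L * θ) • (a' - a)‖ ^ 2 := by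
    rw [← norm_neg (e + h + _ + _ + _), ← eq_neg_of_add_eq_zero_left heq, norm_smul, mul_pow,
      Real.norm_eq_abs, sq_abs]
    ring
  have h2 := sq_norm_add_five_le e h (μ • a') ((10 * L * θ) • V (V a)) ((10 * L * θ) • (a' - a))
  rw [← h1] at h2
  simp only [norm_smul, mul_pow, Real.norm_eq_abs, sq_abs] at h2
  have h3 : ρ * ‖η‖ ^ 2 ≤ θ / 30 * ‖U η‖ ^ 2 := by
    calc ρ * ‖η‖ ^ 2 ≤ ρ * (κ * ‖U η‖ ^ 2) := by gcongr
      _ = (ρ * κ) * ‖U η‖ ^ 2 := by ring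
      _ ≤ _ := by gcongr
  -- The factor 5 of the five-term square bound turns the 600 here into the 120 of the statement.
  have h4 : 5 * L * ρ * ‖η‖ ^ 2 ≤ θ / (600 * L) * (100 * L ^ 2 * ‖U η‖ ^ 2) := by
    have : θ / (600 * L) * (100 * L ^ 2 * ‖U η‖ ^ 2) = 5 * L * (θ / 30 * ‖U η‖ ^ 2) := by
      field_simp; ring
    rw [this, mul_assoc]
    gcongr
  have h5 : 0 ≤ L ^ 2 * θ ^ 2 := by positivity
  have h6 : 100 * L ^ 2 * ‖U η‖ ^ 2 ≤ 5 * (‖e‖ ^ 2 + ‖h‖ ^ 2 + μ ^ 2 * ‖a'‖ ^ 2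
      + 50 * L ^ 2 * θ ^ 2 * ‖V a‖ ^ 2 + 100 * L ^ 2 * θ ^ 2 * ‖a' - a‖ ^ 2) := by
    nlinarith [mul_le_mul_of_nonneg_left hV2 h5]
  refine h4.trans ((mul_le_mul_of_nonneg_left h6 (by positivity)).trans (le_of_eq ?_))
  field_simp; ring

/-- The error terms of `dual_error_le` are dominated by the slack of the primal estimate. -/
lemma dual_coeff_le {L μ θ : ℝ} (hL : 0 < L) (hμ : 0 < μ) (hμL : μ ≤ L) (hθ : 0 < θ)
    (hθ' : θ ≤ 1 / 2) (e h a' v d : ℝ) :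
    θ / (120 * L) * (e ^ 2 + h ^ 2 + μ ^ 2 * a' ^ 2 + 50 * L ^ 2 * θ ^ 2 * v ^ 2
        + 100 * L ^ 2 * θ ^ 2 * d ^ 2)
      ≤ 1 / (4 * L) * e ^ 2 - 1 / (6 * L) * e ^ 2 + θ * (1 / (2 * L) * h ^ 2)
        + θ * μ / 4 * a' ^ 2 + 5 * L * θ ^ 2 * v ^ 2 + 1 / 2 * L * θ ^ 2 * d ^ 2 := by
  have c1 : θ / (120 * L) ≤ 1 / (4 * L) - 1 / (6 * L) := by
    have : 1 / (4 * L) - 1 / (6 * L) = 10 / (120 * L) := by field_simp; norm_num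
    rw [this]
    gcongr
    linarith
  have c2 : θ / (120 * L) ≤ θ * (1 / (2 * L)) := by
    rw [mul_one_div]
    gcongr
    norm_num
  have c3 : θ / (120 * L) * μ ^ 2 ≤ θ * μ / 4 := by
    have : θ / (120 * L) * μ ^ 2 = θ * μ / 120 * (μ / L) := by field_simp
    rw [this]
    have h1 : μ / L ≤ 1 := (div_le_one hL).2 hμL
    have h2 := mul_pos hθ hμ
    nlinarith
  have c4 : θ / (120 * L) * (50 * L ^ 2 * θ ^ 2) ≤ 5 * L * θ ^ 2 := by
    have : θ / (120 * L) * (50 * L ^ 2 * θ ^ 2) = 5 / 12 * L * θ ^ 2 * θ := by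
      field_simp; norm_num
    rw [this]
    have : 0 < L * θ ^ 2 := by positivity
    nlinarith
  have c5 : θ / (120 * L) * (100 * L ^ 2 * θ ^ 2) ≤ 1 / 2 * L * θ ^ 2 := by
    have : θ / (120 * L) * (100 * L ^ 2 * θ ^ 2) = 5 / 6 * L * θ ^ 2 * θ := by
      field_simp; norm_num
    rw [this]
    have : 0 < L * θ ^ 2 := by positivity
    nlinarith
  have d1 := mul_le_mul_of_nonneg_right c1 (sq_nonneg e)
  have d2 := mul_le_mul_of_nonneg_right c2 (sq_nonneg h)
  have d3 := mul_le_mul_of_nonneg_right c3 (sq_nonneg a')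
  have d4 := mul_le_mul_of_nonneg_right c4 (sq_nonneg v)
  have d5 := mul_le_mul_of_nonneg_right c5 (sq_nonneg d)
  linarith

/-- One step of the accelerated primal-dual method, along a realization of the gradient estimator
`g`. Here `y`, `Gy`, `Gs` are the extrapolated point, the gradient there, and the gradient at the
solution `xs` with multiplier `ls`. -/
lemma one_step_le {U V : H →ₗ[ℝ] H} (hU : U.IsSymmetric) (hV : V.IsSymmetric)
    {L μ θ₁ θ₂ κ ρ : ℝ} (hL : 0 < L) (hμ : 0 < μ) (hμL : μ ≤ L) (hθ₁ : 0 < θ₁)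
    (hθ₁' : θ₁ ≤ 1 / 2) (hθ : θ₁ + θ₂ ≤ 1) (hρ : 0 ≤ ρ) (hρκ : ρ * κ ≤ θ₁ / 30)
    (hUV : ∀ v, ‖U v‖ ^ 2 ≤ ‖V v‖ ^ 2) (hV2 : ∀ v, ‖V v‖ ^ 2 ≤ 1 / 2 * ‖v‖ ^ 2)
    {x y z w lam x' z' lam' g Gy Gs xs ls : H} {Fx Fy Fw Fs Fx' : ℝ}
    (hy : y = θ₁ • z + θ₂ • w + (1 - θ₁ - θ₂) • x) (hx' : x' = y + θ₁ • (z' - z))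
    (hlam' : lam' = lam + θ₁ • U z')
    (hz' : (10 * L) • U lam + (10 * L * θ₁) • V (V z) + g + μ • (z' - y)
      + (10 * L * θ₁) • (z' - z) = 0)
    (hUs : U xs = 0) (hVs : V xs = 0) (hls : Gs = -((10 * L) • U ls))
    (hη : ‖lam - ls‖ ^ 2 ≤ κ * ‖U (lam - ls)‖ ^ 2)
    (hFx' : Fx' ≤ Fy + inner ℝ Gy (x' - y) + L / 2 * ‖x' - y‖ ^ 2)
    (hFx : Fy + inner ℝ Gy (x - y) ≤ Fx)
    (hFs : Fy + inner ℝ Gy (xs - y) + μ / 2 * ‖xs - y‖ ^ 2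
      + 1 / (2 * L) * ‖Gs - Gy - μ • (xs - y)‖ ^ 2 ≤ Fs) :
    (Fx' - Fs - inner ℝ Gs (x' - xs)) + (5 * L * θ₁ ^ 2 + θ₁ * μ / 4) * ‖z' - xs‖ ^ 2
        + 5 * L * ‖lam' - ls‖ ^ 2
      ≤ (1 - θ₁ - θ₂) * (Fx - Fs - inner ℝ Gs (x - xs)) + θ₂ * (Fw - Fs - inner ℝ Gs (w - xs))
        - θ₂ * (Fw - Fy - inner ℝ Gy (w - y)) + 1 / (4 * L) * ‖g - Gy‖ ^ 2
        - θ₁ * inner ℝ (g - Gy) (z - xs) + 5 * L * θ₁ ^ 2 * ‖z - xs‖ ^ 2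
        + 5 * L * (1 - ρ) * ‖lam - ls‖ ^ 2 := by
  set a := z - xs with ha
  set a' := z' - xs with ha'
  set q := y - xs with hq
  set η := lam - ls with hη_def
  set e := g - Gy with he
  set h := Gy - Gs - μ • q with hh
  clear_value a a' q η e h
  have hVz : V z = V a := by rw [ha, map_sub, hVs, sub_zero]
  have hUz : U z' = U a' := by rw [ha', map_sub, hUs, sub_zero]
  have hd : z' - z = a' - a := by simp [ha, ha']
  have hη' : lam' - ls = η + θ₁ • U a' := by rw [hlam', hη_def, hUz]; abel
  have hyq : z' - y = a' - q := by simp [ha', hq]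
  rw [hVz, hd, hyq] at hz'
  have hxy : x' - y = θ₁ • (a' - a) := by rw [hx', hd]; abel
  have hxs : xs - y = -q := by simp [hq]
  have hGG : Gs - Gy - μ • (-q) = -h := by rw [hh, smul_neg]; abel
  rw [hxs, norm_neg, inner_neg_right, hGG, norm_neg] at hFs
  rw [hxy, norm_smul, mul_pow, Real.norm_eq_abs, sq_abs, inner_smul_right] at hFx'
  -- The coupling defining `y`, solved for `θ₁ • a`. Convexity disposes of the part along `x - y`;
  -- the part along `w - y` is kept to form the negative Bregman term.
  have hq_eq : θ₁ • a = θ₁ • q - θ₂ • (w - y) - (1 - θ₁ - θ₂) • (x - y) := by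
    have h2 : θ₁ • z = y - θ₂ • w - (1 - θ₁ - θ₂) • x := by rw [hy]; abel
    rw [ha, smul_sub, h2, hq]; module
  have hx's : x' - xs = θ₁ • a' + θ₂ • (w - xs) + (1 - θ₁ - θ₂) • (x - xs) := by
    rw [hx', hd, ← hd, ha', hy]; module
  have hdual := dual_error_le (U := U) (V := V) (μ := μ) hL hθ₁ hρ hρκ a a' η e h (hV2 (V a)) hη (by
    have e1 : (10 * L) • U η = (10 * L) • U lam + Gs := by
      rw [hη_def, map_sub, smul_sub, hls]; abel
    have e2 : h + e = g - Gs - μ • q := by rw [hh, he]; abel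
    rw [e1, ← hz', add_comm e h, e2]; module)

  have i1 : θ₁ * inner ℝ Gy a
      = θ₁ * inner ℝ Gy q - θ₂ * inner ℝ Gy (w - y) - (1 - θ₁ - θ₂) * inner ℝ Gy (x - y) := by
    rw [← inner_smul_right, hq_eq]
    simp only [inner_sub_right, inner_smul_right]
  have i2 : inner ℝ Gs (x' - xs) = θ₁ * inner ℝ Gs a' + θ₂ * inner ℝ Gs (w - xs)
      + (1 - θ₁ - θ₂) * inner ℝ Gs (x - xs) := by
    rw [hx's]; simp only [inner_add_right, inner_smul_right]
  have i3 : inner ℝ Gs a' = -(10 * L * inner ℝ ls (U a')) := by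
    rw [hls, inner_neg_left, real_inner_smul_left, hU]
  have i4 : 10 * L * inner ℝ lam (U a') + 10 * L * θ₁ * inner ℝ (V a) (V a') + inner ℝ g a'
      + μ * inner ℝ (a' - q) a' + 10 * L * θ₁ * inner ℝ (a' - a) a' = 0 := by
    have := congrArg (fun v => inner ℝ v a') hz'
    simpa only [inner_add_left, real_inner_smul_left, inner_zero_left, hU lam a', hV (V a) a']
      using this
  have i5 : inner ℝ g a' = inner ℝ Gy a' + inner ℝ e a' := by
    rw [← inner_add_left]; simp [he]
  have i6 : ‖η + θ₁ • U a'‖ ^ 2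
      = ‖η‖ ^ 2 + 2 * θ₁ * inner ℝ η (U a') + θ₁ ^ 2 * ‖U a'‖ ^ 2 := by
    rw [norm_add_sq_real, norm_smul, mul_pow, Real.norm_eq_abs, sq_abs, inner_smul_right]; ring
  have i7 : inner ℝ η (U a') = inner ℝ lam (U a') - inner ℝ ls (U a') := by
    rw [hη_def, inner_sub_left]
  have i8 : ‖V (a' - a)‖ ^ 2 = ‖V a'‖ ^ 2 - 2 * inner ℝ (V a) (V a') + ‖V a‖ ^ 2 := by
    rw [map_sub, norm_sub_sq_real, real_inner_comm]
  have i9 : 2 * inner ℝ (a' - a) a' = ‖a' - a‖ ^ 2 + ‖a'‖ ^ 2 - ‖a‖ ^ 2 := by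
    rw [inner_sub_left, norm_sub_sq_real, real_inner_self_eq_norm_sq, real_inner_comm]; ring
  have i10 : 2 * inner ℝ (a' - q) a' = ‖a' - q‖ ^ 2 + ‖a'‖ ^ 2 - ‖q‖ ^ 2 := by
    rw [inner_sub_left, norm_sub_sq_real, real_inner_self_eq_norm_sq, real_inner_comm]; ring
  have i11 : inner ℝ Gy (a' - a) = inner ℝ Gy a' - inner ℝ Gy a := inner_sub_right _ _ _
  have i12 : inner ℝ e (a' - a) = inner ℝ e a' - inner ℝ e a := inner_sub_right _ _ _

  -- The noise `e` is correlated with `a'` but not with `a`, so only `a' - a` is estimated by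
  -- Young's inequality. Of the available `5 L θ₁² ‖a' - a‖²`, this step takes `3/2`, the descent
  -- lemma `1/2` and the `V` term `5/2` (in units of `L θ₁²`), leaving `1/2` for the dual error;
  -- likewise `1/(12 L) ‖e‖²` is left over.
  have j1 : -(θ₁ * inner ℝ e (a' - a)) ≤ 1 / (6 * L) * ‖e‖ ^ 2
      + 3 * L / 2 * θ₁ ^ 2 * ‖a' - a‖ ^ 2 := by
    have h1 : 0 ≤ ‖e + (3 * L * θ₁) • (a' - a)‖ ^ 2 := sq_nonneg _
    rw [norm_add_sq_real, norm_smul, mul_pow, Real.norm_eq_abs, sq_abs, inner_smul_right] at h1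
    have h2 := mul_nonneg (by positivity : 0 ≤ 1 / (6 * L)) h1
    have h3 : 1 / (6 * L) * (‖e‖ ^ 2 + 2 * (3 * L * θ₁ * inner ℝ e (a' - a))
        + (3 * L * θ₁) ^ 2 * ‖a' - a‖ ^ 2) = 1 / (6 * L) * ‖e‖ ^ 2 + θ₁ * inner ℝ e (a' - a)
        + 3 * L / 2 * θ₁ ^ 2 * ‖a' - a‖ ^ 2 := by
      field_simp; ring
    linarith
  -- The square of the multiplier increment is absorbed by the `‖V a'‖²` gained from the explicit
  -- `V²` term.
  have j2 := mul_le_mul_of_nonneg_left (hUV a') (by positivity : 0 ≤ 5 * L * θ₁ ^ 2)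
  have j3 := mul_le_mul_of_nonneg_left (hV2 (a' - a)) (by positivity : 0 ≤ 5 * L * θ₁ ^ 2)
  have j4 := mul_le_mul_of_nonneg_left hFs hθ₁.le
  have j5 := mul_le_mul_of_nonneg_left hFx (by linarith : 0 ≤ 1 - θ₁ - θ₂)
  have j6 : 0 ≤ θ₁ * μ / 2 * ‖a' - q‖ ^ 2 := by positivity
  have c := dual_coeff_le hL hμ hμL hθ₁ hθ₁' ‖e‖ ‖h‖ ‖a'‖ ‖V a‖ ‖a' - a‖
  have k1 : Fx' ≤ Fy + θ₁ * inner ℝ g a' - θ₁ * inner ℝ e a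
      + θ₁ * (Fs - Fy - μ / 2 * ‖q‖ ^ 2 - 1 / (2 * L) * ‖h‖ ^ 2) + θ₂ * inner ℝ Gy (w - y)
      + (1 - θ₁ - θ₂) * (Fx - Fy) + 1 / (6 * L) * ‖e‖ ^ 2
      + 2 * L * θ₁ ^ 2 * ‖a' - a‖ ^ 2 := by
    rw [i11] at hFx'
    rw [i12] at j1
    rw [i5]
    linarith
  have k2 : θ₁ * inner ℝ g a' - θ₁ * inner ℝ Gs a' = -(10 * L * θ₁) * inner ℝ η (U a')
      - 10 * L * θ₁ ^ 2 * inner ℝ (V a) (V a') - θ₁ * μ * inner ℝ (a' - q) a'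
      - 10 * L * θ₁ ^ 2 * inner ℝ (a' - a) a' := by
    rw [i3, i7]
    linear_combination θ₁ * i4
  have k3 : θ₁ * μ * inner ℝ (a' - q) a'
      = θ₁ * μ / 2 * (‖a' - q‖ ^ 2 + ‖a'‖ ^ 2 - ‖q‖ ^ 2) := by rw [← i10]; ring
  have k4 : 10 * L * θ₁ ^ 2 * inner ℝ (a' - a) a'
      = 5 * L * θ₁ ^ 2 * (‖a' - a‖ ^ 2 + ‖a'‖ ^ 2 - ‖a‖ ^ 2) := by rw [← i9]; ring
  have k5 : 10 * L * θ₁ ^ 2 * inner ℝ (V a) (V a')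
      = 5 * L * θ₁ ^ 2 * (‖V a'‖ ^ 2 + ‖V a‖ ^ 2 - ‖V (a' - a)‖ ^ 2) := by rw [i8]; ring
  rw [hη', i6, i2]
  linarith

end OneStep

/-! ### Moments of finite product distributions -/

section Sampling

/-- The marginal of a finite product distribution. -/
lemma sum_prod_mul_eq {ι : Type*} [Fintype ι] [DecidableEq ι] {T : Type*} [Fintype T]
    (q : ι → T → ℝ) (hq : ∀ i, ∑ t, q i t = 1) (i₀ : ι) (φ : T → ℝ) :
    ∑ s : ι → T, (∏ i, q i (s i)) * φ (s i₀) = ∑ t, q i₀ t * φ t := by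
  -- Writing `φ (s i₀)` as a product with trivial factors away from `i₀` lets the whole sum factor
  -- over coordinates.
  have h1 : ∀ s : ι → T, (∏ i, q i (s i)) * φ (s i₀)
      = ∏ i, (q i (s i) * if i = i₀ then φ (s i) else 1) := by
    intro s
    rw [Finset.prod_mul_distrib, Finset.prod_ite_eq' Finset.univ i₀ (fun i => φ (s i))]
    simp
  simp_rw [h1]
  have h2 := (Finset.prod_univ_sum (fun _ : ι => (Finset.univ : Finset T))
    (fun i t => q i t * if i = i₀ then φ t else 1)).symm
  rw [Fintype.piFinset_univ] at h2
  rw [h2, Finset.prod_eq_single i₀]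
  · simp
  · intro i _ hi
    simpa [hi] using hq i
  · simp

lemma sum_prod_eq_one {ι : Type*} [Fintype ι] [DecidableEq ι] {T : Type*} [Fintype T]
    (q : ι → T → ℝ) (hq : ∀ i, ∑ t, q i t = 1) :
    ∑ s : ι → T, ∏ i, q i (s i) = 1 := by
  have h2 := (Finset.prod_univ_sum (fun _ : ι => (Finset.univ : Finset T)) q).symm
  rw [Fintype.piFinset_univ] at h2
  rw [h2]
  simp [hq]

variable {E : Type*} [NormedAddCommGroup E] [InnerProductSpace ℝ E]

/-- Sums of independent centred vectors have mean zero. -/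
lemma sum_prod_mul_inner_sum {n : ℕ} (b : ℕ) {p : Fin n → ℝ} (hp : ∑ j, p j = 1) (Y : Fin n → E)
    (hY : ∑ j, p j • Y j = 0) (v : E) :
    ∑ S : Fin b → Fin n, (∏ l, p (S l)) * inner ℝ (∑ l, Y (S l)) v = 0 := by
  simp_rw [sum_inner, Finset.mul_sum]
  rw [Finset.sum_comm]
  refine Finset.sum_eq_zero fun l _ => ?_
  rw [sum_prod_mul_eq (fun _ => p) (fun _ => hp) l (fun j => inner ℝ (Y j) v)]
  simp_rw [← real_inner_smul_left]
  rw [← sum_inner, hY, inner_zero_left]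

/-- The second moment of a sum of independent centred vectors. -/
lemma sum_prod_mul_sq_norm_sum {n : ℕ} {p : Fin n → ℝ} (hp : ∑ j, p j = 1) (Y : Fin n → E)
    (hY : ∑ j, p j • Y j = 0) (b : ℕ) :
    ∑ S : Fin b → Fin n, (∏ l, p (S l)) * ‖∑ l, Y (S l)‖ ^ 2 = b * ∑ j, p j * ‖Y j‖ ^ 2 := by
  induction b with
  | zero => simp
  | succ b ih =>
    rw [← (Fin.consEquiv (fun _ : Fin (b + 1) => Fin n)).sum_comp, Fintype.sum_prod_type]
    -- The first sample is split off; the cross term averages to zero because the remaining samples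
    -- are centred and independent of it.
    have h1 : ∀ (j : Fin n) (S : Fin b → Fin n),
        (∏ l, p ((Fin.consEquiv (fun _ : Fin (b + 1) => Fin n)) (j, S) l)) *
          ‖∑ l, Y ((Fin.consEquiv (fun _ : Fin (b + 1) => Fin n)) (j, S) l)‖ ^ 2
        = p j * ‖Y j‖ ^ 2 * (∏ l, p (S l))
          + 2 * p j * ((∏ l, p (S l)) * inner ℝ (∑ l, Y (S l)) (Y j))
          + p j * ((∏ l, p (S l)) * ‖∑ l, Y (S l)‖ ^ 2) := by
      intro j S
      rw [Fin.prod_univ_succ, Fin.sum_univ_succ]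
      simp only [Fin.consEquiv_apply, Fin.cons_zero, Fin.cons_succ]
      rw [norm_add_sq_real, real_inner_comm]
      ring
    simp_rw [h1, Finset.sum_add_distrib, ← Finset.mul_sum,
      sum_prod_mul_inner_sum b hp Y hY, sum_prod_eq_one (fun _ => p) (fun _ => hp), ih]
    rw [← Finset.sum_mul Finset.univ p, hp]
    push_cast
    simp
    ring

end Sampling

/-! ### Bias and variance of the gradient estimator -/

section Estimator

variable {m n d : ℕ} {D : Problem m n d}

lemma Problem.Regular.differentiable_localObj (hD : D.Regular) (i : Fin m) :
    Differentiable ℝ (D.localObj i) := (hD.local_smooth i).1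

lemma Problem.Regular.gradient_localObj (hD : D.Regular) (i : Fin m) (x : Vec d) :
    gradient (D.localObj i) x = (1 / (n : ℝ)) • ∑ j, gradient (D.f i j) x := by
  refine HasGradientAt.gradient ?_
  rw [hasGradientAt_iff_hasFDerivAt, map_smul, map_sum]
  have h : HasFDerivAt (fun x => ∑ j, D.f i j x)
      (∑ j, InnerProductSpace.toDual ℝ (Vec d) (gradient (D.f i j) x)) x := by
    refine HasFDerivAt.fun_sum fun j _ => ?_
    exact hasGradientAt_iff_hasFDerivAt.1 ((hD.comp_smooth i j).1 x).hasGradientAt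
  exact h.const_mul _

lemma exists_norm_eq_one_vec (hd : 0 < d) : ∃ v : Vec d, ‖v‖ = 1 :=
  ⟨EuclideanSpace.single ⟨0, hd⟩ 1, by simp⟩

lemma Problem.Regular.Lc_nonneg (hD : D.Regular) (hd : 0 < d) (i : Fin m) (j : Fin n) :
    0 ≤ D.Lc i j := by
  obtain ⟨v, hv⟩ := exists_norm_eq_one_vec hd
  have := (hD.comp_smooth i j).2 0 v
  rw [sub_zero, hv, mul_one] at this
  exact (norm_nonneg _).trans this

/-- If all `Lᵢⱼ` vanished, the local gradient would be constant, contradicting strong convexity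
between `0` and a unit vector (hence `0 < d`). This makes the sampling probabilities well defined.
-/
lemma Problem.Regular.sum_Lc_pos (hD : D.Regular) (hd : 0 < d) (i : Fin m) :
    0 < ∑ j, D.Lc i j := by
  refine lt_of_le_of_ne (Finset.sum_nonneg fun j _ => hD.Lc_nonneg hd i j) fun h0 => ?_
  have h1 := (Finset.sum_eq_zero_iff_of_nonneg fun j _ => hD.Lc_nonneg hd i j).1 h0.symm
  obtain ⟨v, hv⟩ := exists_norm_eq_one_vec hd
  have hg : gradient (D.localObj i) v = gradient (D.localObj i) 0 := by
    rw [hD.gradient_localObj, hD.gradient_localObj]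
    congr 1
    refine Finset.sum_congr rfl fun j hj => ?_
    have := (hD.comp_smooth i j).2 0 v
    rw [h1 j hj, zero_mul] at this
    exact sub_eq_zero.1 (norm_le_zero_iff.1 this)
  have ha := add_inner_gradient_le_of_strongConvexOn (hD.local_strongConvex i)
    (hD.differentiable_localObj i) v 0
  have hb := add_inner_gradient_le_of_strongConvexOn (hD.local_strongConvex i)
    (hD.differentiable_localObj i) 0 v
  rw [hg] at hb
  simp only [sub_zero, zero_sub, inner_neg_right, norm_neg, hv] at ha hb
  have := hD.mu_pos
  linarith

lemma Problem.Regular.sum_prob (hD : D.Regular) (hd : 0 < d) (i : Fin m) :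
    ∑ j, D.prob i j = 1 := by
  simp only [Problem.prob]
  rw [← Finset.sum_div, div_self (hD.sum_Lc_pos hd i).ne']

/-- The importance weighted gradient difference of a single sample. -/
def sampleDiff (D : Problem m n d) (i : Fin m) (y w : Vec d) (j : Fin n) : Vec d :=
  (1 / ((n : ℝ) * D.prob i j)) • (gradient (D.f i j) y - gradient (D.f i j) w)

/-- Components with `Lᵢⱼ = 0` are never sampled and their importance weight is a division by zero;
since their gradient is constant, they contribute nothing anyway. -/
lemma Problem.Regular.gradient_sub_eq_zero (hD : D.Regular) (i : Fin m) (j : Fin n)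
    (h : D.Lc i j = 0) (y w : Vec d) : gradient (D.f i j) y - gradient (D.f i j) w = 0 := by
  have := (hD.comp_smooth i j).2 w y
  rw [h, zero_mul] at this
  exact norm_le_zero_iff.1 this

lemma Problem.Regular.sum_prob_smul_sampleDiff (hD : D.Regular) (hd : 0 < d) (i : Fin m)
    (y w : Vec d) : ∑ j, D.prob i j • sampleDiff D i y w j
      = gradient (D.localObj i) y - gradient (D.localObj i) w := by
  rw [hD.gradient_localObj, hD.gradient_localObj, ← smul_sub, ← Finset.sum_sub_distrib,
    Finset.smul_sum]
  refine Finset.sum_congr rfl fun j _ => ?_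
  rcases eq_or_ne (D.Lc i j) 0 with h | h
  · rw [sampleDiff, hD.gradient_sub_eq_zero i j h]; simp
  · have hp : D.prob i j ≠ 0 := div_ne_zero h (hD.sum_Lc_pos hd i).ne'
    rw [sampleDiff, smul_smul]
    congr 1
    field_simp

/-- Since `pᵢⱼ` is proportional to `Lᵢⱼ`, the weight `1 / (n² pᵢⱼ)` equals `L̄ᵢ / (n Lᵢⱼ)`, which
cancels the constant `2 Lᵢⱼ` from the cocoercivity of each component. -/
lemma Problem.Regular.sum_prob_mul_sq_norm_sampleDiff_le (hD : D.Regular) (hd : 0 < d)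
    (hn : 0 < n) (i : Fin m) (y w : Vec d) :
    ∑ j, D.prob i j * ‖sampleDiff D i y w j‖ ^ 2 ≤ 2 * D.Lbar i *
      (D.localObj i w - D.localObj i y - inner ℝ (gradient (D.localObj i) y) (w - y)) := by
  have hS := hD.sum_Lc_pos hd i
  have hn' : (0 : ℝ) < n := by exact_mod_cast hn
  have hB : D.localObj i w - D.localObj i y - inner ℝ (gradient (D.localObj i) y) (w - y)
      = 1 / (n : ℝ) * ∑ j, (D.f i j w - D.f i j y - inner ℝ (gradient (D.f i j) y) (w - y)) := by
    rw [hD.gradient_localObj, real_inner_smul_left, sum_inner]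
    simp only [Problem.localObj, Finset.sum_sub_distrib]
    ring
  rw [hB, ← mul_assoc, Finset.mul_sum]
  refine Finset.sum_le_sum fun j _ => ?_
  have hconv : StrongConvexOn Set.univ 0 (D.f i j) := strongConvexOn_zero.2 (hD.comp_convex i j)
  have hbar : 0 < D.Lbar i := by rw [Problem.Lbar]; positivity
  rcases eq_or_ne (D.Lc i j) 0 with h | h
  · rw [sampleDiff, hD.gradient_sub_eq_zero i j h]
    have := add_inner_gradient_le_of_strongConvexOn hconv (hD.comp_smooth i j).1 w y
    have h0 : 0 ≤ D.f i j w - D.f i j y - inner ℝ (gradient (D.f i j) y) (w - y) := by linarith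
    have : 0 ≤ 2 * D.Lbar i * (1 / (n : ℝ)) *
      (D.f i j w - D.f i j y - inner ℝ (gradient (D.f i j) y) (w - y)) := by positivity
    simpa using! this
  · have hL : 0 < D.Lc i j := lt_of_le_of_ne (hD.Lc_nonneg hd i j) h.symm
    have := add_sq_norm_gradient_sub_le_of_strongConvexOn le_rfl hL hconv
      (hD.comp_smooth i j).1 (hD.comp_smooth i j).2 w y
    have h1 : 1 / (2 * D.Lc i j) * ‖gradient (D.f i j) y - gradient (D.f i j) w‖ ^ 2
        ≤ D.f i j w - D.f i j y - inner ℝ (gradient (D.f i j) y) (w - y) := by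
      rw [zero_smul, sub_zero, norm_sub_rev (gradient (D.f i j) w)] at this
      linarith
    have h2 := mul_le_mul_of_nonneg_left h1
      (by positivity : 0 ≤ 2 * D.Lbar i * (1 / (n : ℝ)))
    refine le_trans (le_of_eq ?_) h2
    rw [sampleDiff, norm_smul, mul_pow, Real.norm_eq_abs, sq_abs, Problem.prob, Problem.Lbar]
    field_simp

lemma vrGradient_sub_eq {b : ℕ} (hb : 0 < b) (i : Fin m) (S : Fin b → Fin n) (y w : Vec d) :
    vrGradient D i S y w - gradient (D.localObj i) y = (1 / (b : ℝ)) • ∑ l, (sampleDiff D i y w (S l)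
      - (gradient (D.localObj i) y - gradient (D.localObj i) w)) := by
  have hb' : (b : ℝ) ≠ 0 := by exact_mod_cast hb.ne'
  simp only [vrGradient, Finset.sum_sub_distrib, smul_sub, Finset.sum_const, Finset.card_univ,
    Fintype.card_fin, sampleDiff, ← Nat.cast_smul_eq_nsmul ℝ, smul_smul]
  rw [one_div_mul_cancel hb', one_smul, one_smul]
  abel

lemma Problem.Regular.sum_prob_smul_centred (hD : D.Regular) (hd : 0 < d) (i : Fin m)
    (y w : Vec d) : ∑ j, D.prob i j • (sampleDiff D i y w j
      - (gradient (D.localObj i) y - gradient (D.localObj i) w)) = 0 := by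
  simp_rw [smul_sub _ (sampleDiff _ _ _ _ _)]
  rw [Finset.sum_sub_distrib, hD.sum_prob_smul_sampleDiff hd, ← Finset.sum_smul,
    hD.sum_prob hd, one_smul, sub_self]

/-- The estimator is unbiased. -/
lemma Problem.Regular.sum_inner_vrGradient_sub (hD : D.Regular) (hd : 0 < d) {b : ℕ} (hb : 0 < b)
    (i : Fin m) (y w v : Vec d) :
    ∑ S : Fin b → Fin n, (∏ l, D.prob i (S l)) *
      inner ℝ (vrGradient D i S y w - gradient (D.localObj i) y) v = 0 := by
  simp_rw [vrGradient_sub_eq hb, real_inner_smul_left, mul_left_comm _ (1 / (b : ℝ))]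
  rw [← Finset.mul_sum, sum_prod_mul_inner_sum b (hD.sum_prob hd i) _
    (hD.sum_prob_smul_centred hd i y w), mul_zero]

/-- The variance bound of the estimator. -/
lemma Problem.Regular.sum_sq_norm_vrGradient_sub_le (hD : D.Regular) (hd : 0 < d) (hn : 0 < n)
    {b : ℕ} (hb : 0 < b) (i : Fin m) (y w : Vec d) :
    ∑ S : Fin b → Fin n, (∏ l, D.prob i (S l)) *
      ‖vrGradient D i S y w - gradient (D.localObj i) y‖ ^ 2 ≤ 2 * D.Lbar i / b *
      (D.localObj i w - D.localObj i y - inner ℝ (gradient (D.localObj i) y) (w - y)) := by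
  have hb' : (0 : ℝ) < b := by exact_mod_cast hb
  simp_rw [vrGradient_sub_eq hb, norm_smul, mul_pow, mul_left_comm _ (‖1 / (b : ℝ)‖ ^ 2)]
  rw [← Finset.mul_sum, sum_prod_mul_sq_norm_sum (hD.sum_prob hd i) _
    (hD.sum_prob_smul_centred hd i y w), Real.norm_eq_abs, sq_abs]
  -- Centring at the mean can only decrease the second moment.
  have h1 : ∑ j, D.prob i j * ‖sampleDiff D i y w j
      - (gradient (D.localObj i) y - gradient (D.localObj i) w)‖ ^ 2
      ≤ ∑ j, D.prob i j * ‖sampleDiff D i y w j‖ ^ 2 := by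
    set G := gradient (D.localObj i) y - gradient (D.localObj i) w with hG
    have h2 : ∀ j, D.prob i j * ‖sampleDiff D i y w j - G‖ ^ 2
        = D.prob i j * ‖sampleDiff D i y w j‖ ^ 2
          - 2 * inner ℝ (D.prob i j • sampleDiff D i y w j) G + D.prob i j * ‖G‖ ^ 2 := by
      intro j
      rw [norm_sub_sq_real, real_inner_smul_left]; ring
    simp_rw [h2]
    rw [Finset.sum_add_distrib, Finset.sum_sub_distrib, ← Finset.mul_sum, ← sum_inner,
      hD.sum_prob_smul_sampleDiff hd, ← hG, ← Finset.sum_mul, hD.sum_prob hd,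
      real_inner_self_eq_norm_sq]
    nlinarith [sq_nonneg ‖G‖]
  have h2 := h1.trans (hD.sum_prob_mul_sq_norm_sampleDiff_le hd hn i y w)
  have h3 := mul_le_mul_of_nonneg_left h2 (by positivity : (0 : ℝ) ≤ 1 / b)
  refine le_trans (le_of_eq ?_) (h3.trans (le_of_eq ?_))
  · field_simp
  · ring

end Estimator

/-! ### Matrices acting on the Frobenius space -/

section StackedSpace

variable {m d : ℕ}

lemma sqNorm_eq_norm_toLp (x : Stacked m d) : sqNorm x = ‖WithLp.toLp 2 x‖ ^ 2 := by
  rw [PiLp.norm_sq_eq_of_L2]; rfl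

lemma sqNorm_nonneg (x : Stacked m d) : 0 ≤ sqNorm x :=
  Finset.sum_nonneg fun _ _ => sq_nonneg _

/-- The action of a matrix on stacked variables, as a linear map for the Frobenius structure. -/
def mixLin (A : Matrix (Fin m) (Fin m) ℝ) :
    PiLp 2 (fun _ : Fin m => Vec d) →ₗ[ℝ] PiLp 2 (fun _ : Fin m => Vec d) where
  toFun x := WithLp.toLp 2 (mix A x.ofLp)
  map_add' x y := by
    ext1 i
    simp [mix, Finset.sum_add_distrib]
  map_smul' c x := by
    ext1 i
    simp [mix, Finset.smul_sum, smul_comm c]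

lemma mixLin_toLp (A : Matrix (Fin m) (Fin m) ℝ) (x : Stacked m d) :
    mixLin A (WithLp.toLp 2 x) = WithLp.toLp 2 (mix A x) := rfl

lemma mixLin_isSymmetric {A : Matrix (Fin m) (Fin m) ℝ} (hA : A.IsSymm) :
    (mixLin (d := d) A).IsSymmetric := by
  intro x y
  rw [PiLp.inner_apply, PiLp.inner_apply]
  simp only [mixLin, LinearMap.coe_mk, AddHom.coe_mk, mix, sum_inner, inner_sum,
    real_inner_smul_left, inner_smul_right]
  rw [Finset.sum_comm]
  refine Finset.sum_congr rfl fun i _ => Finset.sum_congr rfl fun j _ => ?_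
  rw [hA.apply i j]

lemma mix_mul (A B : Matrix (Fin m) (Fin m) ℝ) (x : Stacked m d) :
    mix (A * B) x = mix A (mix B x) := by
  funext i
  simp only [mix, Matrix.mul_apply, Finset.sum_smul, Finset.smul_sum, smul_smul]
  exact Finset.sum_comm

/-- A stacked vector whose rows sum to zero is `U u` for some `u` in the range of `U`. -/
lemma exists_mix_mix_eq {U V : Matrix (Fin m) (Fin m) ℝ} {κ : ℝ} (h : MixingPair d U V κ)
    (G : Stacked m d) (hG : ∑ i, G i = 0) :
    ∃ u : Stacked m d, mix U (mix U u) = G := by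
  have hs := mixLin_isSymmetric (d := d) h.U_symm
  -- By symmetry the range of `U` is the orthogonal complement of its kernel, the consensus
  -- subspace; orthogonality to consensus vectors is exactly a zero row sum.
  have h1 : WithLp.toLp 2 G ∈ (mixLin (d := d) U).range := by
    rw [← Submodule.orthogonal_orthogonal (mixLin (d := d) U).range, hs.orthogonal_range,
      Submodule.mem_orthogonal]
    intro v hv
    have hv0 : mix U v.ofLp = 0 := by
      have := congrArg WithLp.ofLp (LinearMap.mem_ker.1 hv)
      simpa [mixLin] using! this
    have hc := (h.U_ker _).1 hv0
    rw [PiLp.inner_apply]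
    rcases isEmpty_or_nonempty (Fin m) with he | ⟨⟨i₀⟩⟩
    · simp
    · have : ∀ i, inner ℝ (v.ofLp i) (G i) = inner ℝ (v.ofLp i₀) (G i) := fun i => by rw [hc i i₀]
      simp only [this]
      rw [← inner_sum, hG, inner_zero_right]
  obtain ⟨u, hu⟩ := h1
  -- The kernel component of the preimage is invisible to `U`, so the preimage can be taken in the
  -- range.
  obtain ⟨r, hr, k, hk, rfl⟩ :=
    (mixLin (d := d) U).range.exists_add_mem_mem_orthogonal u
  obtain ⟨t, rfl⟩ := hr
  rw [hs.orthogonal_range, LinearMap.mem_ker] at hk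
  rw [map_add, hk, add_zero] at hu
  refine ⟨t.ofLp, ?_⟩
  simpa [mixLin] using! congrArg WithLp.ofLp hu

end StackedSpace

/-! ### The step inequality for the stacked iterates -/

section Lyapunov

variable {m n d : ℕ} {D : Problem m n d}

/-- The sum of the Bregman divergences of the local objectives at the solution. -/
def breg (D : Problem m n d) (xs : Vec d) (i : Fin m) (v : Vec d) : ℝ :=
  D.localObj i v - D.localObj i xs - inner ℝ (gradient (D.localObj i) xs) (v - xs)

lemma Problem.L_le_Lf (D : Problem m n d) (i : Fin m) : D.L i ≤ D.Lf :=
  le_ciSup (Set.finite_range D.L).bddAbove i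

lemma Problem.Lbar_le_Lbarf (D : Problem m n d) (i : Fin m) : D.Lbar i ≤ D.Lbarf :=
  le_ciSup (Set.finite_range D.Lbar).bddAbove i

lemma Problem.Regular.lipschitz_gradient (hD : D.Regular) (i : Fin m) (x y : Vec d) :
    ‖gradient (D.localObj i) y - gradient (D.localObj i) x‖ ≤ D.Lf * ‖y - x‖ :=
  ((hD.local_smooth i).2 x y).trans
    (mul_le_mul_of_nonneg_right (D.L_le_Lf i) (norm_nonneg _))

lemma Problem.Regular.inner_gradient_le (hD : D.Regular) (i : Fin m) (x y : Vec d) :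
    D.localObj i y + inner ℝ (gradient (D.localObj i) y) (x - y) ≤ D.localObj i x := by
  have := add_inner_gradient_le_of_strongConvexOn (hD.local_strongConvex i)
    (hD.differentiable_localObj i) x y
  have h2 : 0 ≤ D.μ / 2 * ‖x - y‖ ^ 2 := by have := hD.mu_pos; positivity
  linarith

lemma Problem.Regular.breg_nonneg (hD : D.Regular) (xs : Vec d) (i : Fin m) (v : Vec d) :
    0 ≤ breg D xs i v := by
  have := hD.inner_gradient_le i v xs
  unfold breg
  linarith

/-- The optimality condition behind the update of `z`. -/
lemma prox_step_eq {E : Type*} [AddCommGroup E] [Module ℝ E] {L μ θ α : ℝ} (hL : 0 < L)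
    (hμ : 0 < μ) (hθ : 0 < θ) (hα : α = 1 / (10 * L)) {z' y z g u v : E}
    (hz' : z' = (1 / (1 + μ * α / θ)) • ((μ * α / θ) • y + z - (1 / θ) • (α • g + u + θ • v))) :
    (10 * L) • u + (10 * L * θ) • v + g + μ • (z' - y) + (10 * L * θ) • (z' - z) = 0 := by
  have hpos : 0 < 1 + μ * α / θ := by rw [hα]; positivity
  have h1 : (1 + μ * α / θ) • z' = (μ * α / θ) • y + z - (1 / θ) • (α • g + u + θ • v) := by
    rw [hz', smul_smul, mul_one_div_cancel hpos.ne', one_smul]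
  have h2 := congrArg (fun t => (10 * L * θ) • t) h1
  simp only [smul_add, smul_sub, smul_smul] at h2
  have c1 : 10 * L * θ * (1 + μ * α / θ) = 10 * L * θ + μ := by
    rw [hα]; field_simp
  have c2 : 10 * L * θ * (μ * α / θ) = μ := by rw [hα]; field_simp
  have c3 : 10 * L * θ * (1 / θ * α) = 1 := by rw [hα]; field_simp
  have c4 : 10 * L * θ * (1 / θ) = 10 * L := by field_simp
  have c5 : 10 * L * θ * (1 / θ * θ) = 10 * L * θ := by field_simp
  rw [c1, c2, c3, c4, c5, one_smul] at h2
  have h3 : (10 * L) • u + (10 * L * θ) • v + g + μ • (z' - y) + (10 * L * θ) • (z' - z)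
      = (10 * L * θ + μ) • z' - (μ • y + (10 * L * θ) • z - (g + (10 * L) • u + (10 * L * θ) • v))
      := by module
  rw [h3, h2, sub_self]

/-- The extrapolated point of node `i`. -/
def extrap (p : Params) (s : State m d) (i : Fin m) : Vec d :=
  p.θ₁ • s.z i + p.θ₂ • s.w i + (1 - p.θ₁ - p.θ₂) • s.x i

/-- The error of the gradient estimator of node `i`. -/
def gradErr (D : Problem m n d) (p : Params) (s : State m d) (i : Fin m)
    (S : Fin p.b → Fin n) : Vec d :=
  vrGradient D i S (extrap p s i) (s.w i) - gradient (D.localObj i) (extrap p s i)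

/-- The conditions on the parameters under which the iteration contracts at rate `1 - ρ`. -/
structure Admissible (D : Problem m n d) (p : Params) (κ ρ : ℝ) : Prop where
  mu_le : D.μ ≤ D.Lf
  alpha_eq : p.α = 1 / (10 * D.Lf)
  theta1_pos : 0 < p.θ₁
  theta1_le : p.θ₁ ≤ 1 / 2
  theta2_le : p.θ₂ ≤ 1 / 2
  theta2_eq : p.θ₂ = D.Lbarf / (2 * D.Lf * p.b)
  b_pos : 0 < p.b
  b_le : p.b ≤ n
  rho_nonneg : 0 ≤ ρ
  rho_le : ρ ≤ 1 / 2
  rho_kappa : ρ * κ ≤ p.θ₁ / 30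
  rho_le_theta : ρ ≤ p.θ₁ / 2
  rho_mul : ρ * (n / p.b * (p.θ₂ + p.θ₁ / 2)) ≤ p.θ₁ / 2
  rho_z : ρ * (5 * D.Lf * p.θ₁ ^ 2 + p.θ₁ * D.μ / 4) ≤ p.θ₁ * D.μ / 4

/-- One step of the method, along a realization of the randomness. -/
lemma step_le (hD : D.Regular) {U V : Matrix (Fin m) (Fin m) ℝ} {κ ρ : ℝ}
    (hUV : MixingPair d U V κ) (hκ : 0 < κ) {p : Params} (hp : Admissible D p κ ρ) {xs : Vec d}
    {us : Stacked m d} (hus : ∀ i, gradient (D.localObj i) xs = -((10 * D.Lf) • mix U (mix U us) i))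
    (s : State m d) (hs : ∃ u, s.lam = mix U u) (ξ : Noise m n p.b) :
    ∑ i, breg D xs i ((step D U V p s ξ).x i)
        + (5 * D.Lf * p.θ₁ ^ 2 + p.θ₁ * D.μ / 4)
          * sqNorm ((step D U V p s ξ).z - fun _ => xs)
        + 5 * D.Lf * sqNorm ((step D U V p s ξ).lam - mix U us)
      ≤ (1 - p.θ₁ - p.θ₂) * ∑ i, breg D xs i (s.x i) + p.θ₂ * ∑ i, breg D xs i (s.w i)
        - p.θ₂ * ∑ i, (D.localObj i (s.w i) - D.localObj i (extrap p s i)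
          - inner ℝ (gradient (D.localObj i) (extrap p s i)) (s.w i - extrap p s i))
        + 1 / (4 * D.Lf) * ∑ i, ‖gradErr D p s i (ξ i).1‖ ^ 2
        - p.θ₁ * ∑ i, inner ℝ (gradErr D p s i (ξ i).1) (s.z i - xs)
        + 5 * D.Lf * p.θ₁ ^ 2 * sqNorm (s.z - fun _ => xs)
        + 5 * D.Lf * (1 - ρ) * sqNorm (s.lam - mix U us) := by
  have hμ := hD.mu_pos
  have hL : 0 < D.Lf := hμ.trans_le hp.mu_le
  obtain ⟨u, hu⟩ := hs
  set s' := step D U V p s ξ with hs'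
  let T : Stacked m d → PiLp 2 (fun _ : Fin m => Vec d) := fun x => WithLp.toLp 2 x
  have hz' : ∀ i, (10 * D.Lf) • mix U s.lam i + (10 * D.Lf * p.θ₁) • mix V (mix V s.z) i
      + vrGradient D i (ξ i).1 (extrap p s i) (s.w i) + D.μ • (s'.z i - extrap p s i)
      + (10 * D.Lf * p.θ₁) • (s'.z i - s.z i) = 0 := by
    intro i
    refine prox_step_eq hL hμ hp.theta1_pos hp.alpha_eq ?_
    rw [← mix_mul]
    rfl
  have hker : ∀ x : Stacked m d, (∀ i j, x i = x j) → mixLin U (T x) = 0 ∧ mixLin V (T x) = 0 := by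
    intro x hx
    constructor
    · rw [mixLin_toLp, (hUV.U_ker x).2 hx]; rfl
    · rw [mixLin_toLp, (hUV.V_ker x).2 hx]; rfl
  have key := one_step_le (mixLin_isSymmetric (d := d) hUV.U_symm)
    (mixLin_isSymmetric (d := d) hUV.V_symm) hL hμ hp.mu_le hp.theta1_pos hp.theta1_le
    (by linarith [hp.theta1_le, hp.theta2_le] : p.θ₁ + p.θ₂ ≤ 1) hp.rho_nonneg hp.rho_kappa
    (fun v => by simpa [sqNorm_eq_norm_toLp, mixLin] using! hUV.U_le_V v.ofLp)
    (fun v => by simpa [sqNorm_eq_norm_toLp, mixLin] using! hUV.V_le v.ofLp)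
    (x := T s.x) (y := T (extrap p s)) (z := T s.z) (w := T s.w) (lam := T s.lam) (x' := T s'.x)
    (z' := T s'.z) (lam' := T s'.lam)
    (g := T fun i => vrGradient D i (ξ i).1 (extrap p s i) (s.w i))
    (Gy := T fun i => gradient (D.localObj i) (extrap p s i))
    (Gs := T fun i => gradient (D.localObj i) xs) (xs := T fun _ => xs) (ls := T (mix U us))
    (Fx := ∑ i, D.localObj i (s.x i)) (Fy := ∑ i, D.localObj i (extrap p s i))
    (Fw := ∑ i, D.localObj i (s.w i)) (Fs := ∑ i, D.localObj i xs)
    (Fx' := ∑ i, D.localObj i (s'.x i))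
    rfl rfl rfl
    (by
      ext1 i
      exact hz' i)
    (hker _ fun _ _ => rfl).1 (hker _ fun _ _ => rfl).2
    (by
      ext1 i
      exact hus i)
    -- Both multipliers lie in the range of `U`, hence so does their difference, which is where the
    -- lower bound with `κ` applies.
    (by
      have := hUV.U_ge (mix U (u - us)) ⟨_, rfl⟩
      have e : mix U (u - us) = s.lam - mix U us := by
        have := congrArg WithLp.ofLp (map_sub (mixLin (d := d) U) (T u) (T us))
        rw [hu]
        exact this
      rw [e, sqNorm_eq_norm_toLp, sqNorm_eq_norm_toLp, one_div, inv_mul_le_iff₀ hκ] at this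
      exact this)
    (by
      rw [PiLp.inner_apply, PiLp.norm_sq_eq_of_L2, Finset.mul_sum, ← Finset.sum_add_distrib,
        ← Finset.sum_add_distrib]
      exact Finset.sum_le_sum fun i _ => le_add_inner_gradient_of_lipschitz
        (hD.differentiable_localObj i) (hD.lipschitz_gradient i) _ _)
    (by
      rw [PiLp.inner_apply, ← Finset.sum_add_distrib]
      exact Finset.sum_le_sum fun i _ => hD.inner_gradient_le i _ _)
    (by
      rw [PiLp.inner_apply, PiLp.norm_sq_eq_of_L2, PiLp.norm_sq_eq_of_L2, Finset.mul_sum,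
        Finset.mul_sum, ← Finset.sum_add_distrib, ← Finset.sum_add_distrib,
        ← Finset.sum_add_distrib]
      exact Finset.sum_le_sum fun i _ => add_sq_norm_gradient_sub_le_of_strongConvexOn hμ.le hL
        (hD.local_strongConvex i) (hD.differentiable_localObj i) (hD.lipschitz_gradient i) _ _)
  have hb : ∀ x : Stacked m d, ∑ i, breg D xs i (x i) = ∑ i, D.localObj i (x i)
      - ∑ i, D.localObj i xs
      - inner ℝ (T fun i => gradient (D.localObj i) xs) (T x - T fun _ => xs) := by
    intro x
    rw [PiLp.inner_apply, ← Finset.sum_sub_distrib, ← Finset.sum_sub_distrib]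
    rfl
  have hB : ∑ i, (D.localObj i (s.w i) - D.localObj i (extrap p s i)
          - inner ℝ (gradient (D.localObj i) (extrap p s i)) (s.w i - extrap p s i))
      = ∑ i, D.localObj i (s.w i) - ∑ i, D.localObj i (extrap p s i)
      - inner ℝ (T fun i => gradient (D.localObj i) (extrap p s i)) (T s.w - T (extrap p s)) := by
    rw [PiLp.inner_apply, ← Finset.sum_sub_distrib, ← Finset.sum_sub_distrib]
    rfl
  have he : ∑ i, ‖gradErr D p s i (ξ i).1‖ ^ 2
      = ‖(T fun i => vrGradient D i (ξ i).1 (extrap p s i) (s.w i))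
        - T fun i => gradient (D.localObj i) (extrap p s i)‖ ^ 2 := by
    rw [PiLp.norm_sq_eq_of_L2]; rfl
  have hi : ∑ i, inner ℝ (gradErr D p s i (ξ i).1) (s.z i - xs)
      = inner ℝ ((T fun i => vrGradient D i (ξ i).1 (extrap p s i) (s.w i))
        - T fun i => gradient (D.localObj i) (extrap p s i)) (T s.z - T fun _ => xs) := by
    rw [PiLp.inner_apply]; rfl
  rw [hb, hb, hb, hB, he, hi]
  simp only [sqNorm_eq_norm_toLp]
  exact key

end Lyapunov

/-! ### Contraction of the Lyapunov function over one iteration -/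

section Expectation

variable {m n d : ℕ} {D : Problem m n d}

/-- The expectation of a function of the randomness of one iteration. -/
def expNoise (D : Problem m n d) (b : ℕ) (φ : Noise m n b → ℝ) : ℝ :=
  ∑ s, noiseWeight D b s * φ s

lemma expNoise_add (b : ℕ) (φ ψ : Noise m n b → ℝ) :
    expNoise D b (fun s => φ s + ψ s) = expNoise D b φ + expNoise D b ψ := by
  simp only [expNoise, mul_add, Finset.sum_add_distrib]

lemma expNoise_const_mul (b : ℕ) (c : ℝ) (φ : Noise m n b → ℝ) :
    expNoise D b (fun s => c * φ s) = c * expNoise D b φ := by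
  simp only [expNoise, Finset.mul_sum, mul_left_comm]

lemma expNoise_sum (b : ℕ) (φ : Fin m → Noise m n b → ℝ) :
    expNoise D b (fun s => ∑ i, φ i s) = ∑ i, expNoise D b (φ i) := by
  simp only [expNoise, Finset.mul_sum]
  exact Finset.sum_comm

lemma Problem.Regular.prob_nonneg (hD : D.Regular) (hd : 0 < d) (i : Fin m) (j : Fin n) :
    0 ≤ D.prob i j := div_nonneg (hD.Lc_nonneg hd i j) (hD.sum_Lc_pos hd i).le

lemma Problem.Regular.noiseWeight_nonneg (hD : D.Regular) (hd : 0 < d) {b : ℕ} (hb : b ≤ n)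
    (s : Noise m n b) : 0 ≤ noiseWeight D b s := by
  refine Finset.prod_nonneg fun i _ => mul_nonneg
    (Finset.prod_nonneg fun l _ => hD.prob_nonneg hd i _) ?_
  have h : (b : ℝ) / n ≤ 1 := div_le_one_of_le₀ (by exact_mod_cast hb) (Nat.cast_nonneg n)
  split_ifs
  · positivity
  · linarith

lemma Problem.Regular.expNoise_mono (hD : D.Regular) (hd : 0 < d) {b : ℕ} (hb : b ≤ n)
    {φ ψ : Noise m n b → ℝ} (h : ∀ s, φ s ≤ ψ s) : expNoise D b φ ≤ expNoise D b ψ :=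
  Finset.sum_le_sum fun s _ => mul_le_mul_of_nonneg_left (h s) (hD.noiseWeight_nonneg hd hb s)

lemma Problem.Regular.sum_prod_prob (hD : D.Regular) (hd : 0 < d) (b : ℕ) (i : Fin m) :
    ∑ S : Fin b → Fin n, ∏ l, D.prob i (S l) = 1 :=
  sum_prod_eq_one (fun _ => D.prob i) (fun _ => hD.sum_prob hd i)

/-- The other nodes integrate out and the coin of node `i` is independent of its samples. The two
branches serve both the snapshot refresh and the count of evaluations. -/
lemma Problem.Regular.expNoise_node (hD : D.Regular) (hd : 0 < d) (b : ℕ) (i : Fin m)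
    (φ : (Fin b → Fin n) → ℝ) (c : (Fin b → Fin n) → ℝ) :
    expNoise D b (fun s => if (s i).2 then φ (s i).1 else c (s i).1)
      = (b : ℝ) / n * ∑ S : Fin b → Fin n, (∏ l, D.prob i (S l)) * φ S
        + (1 - (b : ℝ) / n) * ∑ S : Fin b → Fin n, (∏ l, D.prob i (S l)) * c S := by
  have h := sum_prod_mul_eq (T := (Fin b → Fin n) × Bool)
    (fun (i : Fin m) t => (∏ l, D.prob i (t.1 l)) * (if t.2 then (b : ℝ) / n else 1 - (b : ℝ) / n))
    (fun i => by
      simp only [Fintype.sum_prod_type, Fintype.sum_bool, if_true, Bool.false_eq_true, if_false,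
        ← mul_add]
      rw [← Finset.sum_mul, hD.sum_prod_prob hd]
      ring) i (fun t => if t.2 then φ t.1 else c t.1)
  refine h.trans ?_
  simp only [Fintype.sum_prod_type, Fintype.sum_bool, if_true, Bool.false_eq_true, if_false,
    Finset.sum_add_distrib, Finset.mul_sum]
  congr 1 <;> exact Finset.sum_congr rfl fun S _ => by ring

lemma Problem.Regular.expNoise_sample (hD : D.Regular) (hd : 0 < d) (b : ℕ) (i : Fin m)
    (φ : (Fin b → Fin n) → ℝ) :
    expNoise D b (fun s => φ (s i).1) = ∑ S : Fin b → Fin n, (∏ l, D.prob i (S l)) * φ S := by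
  have := hD.expNoise_node hd b i φ φ
  simp only [ite_self] at this
  rw [this]; ring

lemma Problem.Regular.expNoise_const (hD : D.Regular) (hd : 0 < d) (hm : 0 < m) (b : ℕ) (c : ℝ) :
    expNoise D b (fun _ => c) = c := by
  have := hD.expNoise_sample hd b ⟨0, hm⟩ (fun _ => c)
  rw [this, ← Finset.sum_mul, hD.sum_prod_prob hd, one_mul]

/-- The Lyapunov function of the method. -/
def lyap (D : Problem m n d) (U : Matrix (Fin m) (Fin m) ℝ) (p : Params) (xs : Vec d)
    (us : Stacked m d) (s : State m d) : ℝ :=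
  (1 - p.θ₂ - p.θ₁ / 2) * ∑ i, breg D xs i (s.x i)
    + n / p.b * (p.θ₂ + p.θ₁ / 2) * ∑ i, breg D xs i (s.w i)
    + (5 * D.Lf * p.θ₁ ^ 2 + p.θ₁ * D.μ / 4) * sqNorm (s.z - fun _ => xs)
    + 5 * D.Lf * sqNorm (s.lam - mix U us)

/-- The Lyapunov function contracts in expectation. -/
lemma expNoise_lyap_step_le (hD : D.Regular) (hm : 0 < m) (hn : 0 < n) (hd : 0 < d)
    {U V : Matrix (Fin m) (Fin m) ℝ} {κ ρ : ℝ}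
    (hUV : MixingPair d U V κ) (hκ : 0 < κ) {p : Params} (hp : Admissible D p κ ρ) {xs : Vec d}
    {us : Stacked m d} (hus : ∀ i, gradient (D.localObj i) xs = -((10 * D.Lf) • mix U (mix U us) i))
    (s : State m d) (hs : ∃ u, s.lam = mix U u) :
    expNoise D p.b (fun ξ => lyap D U p xs us (step D U V p s ξ)) ≤ (1 - ρ) * lyap D U p xs us s := by
  have hμ := hD.mu_pos
  have hL : 0 < D.Lf := hμ.trans_le hp.mu_le
  have hb' : (0 : ℝ) < p.b := by exact_mod_cast hp.b_pos
  have hn' : (0 : ℝ) < n := by exact_mod_cast hn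
  set P := 5 * D.Lf * p.θ₁ ^ 2 + p.θ₁ * D.μ / 4 with hP
  set β := (n : ℝ) / p.b * (p.θ₂ + p.θ₁ / 2) with hβ
  set EX := expNoise D p.b (fun ξ => ∑ i, breg D xs i ((step D U V p s ξ).x i)) with hEX
  set EW := expNoise D p.b (fun ξ => ∑ i, breg D xs i ((step D U V p s ξ).w i)) with hEW
  set EZ := expNoise D p.b (fun ξ => sqNorm ((step D U V p s ξ).z - fun _ => xs)) with hEZ
  set EΛ := expNoise D p.b (fun ξ => sqNorm ((step D U V p s ξ).lam - mix U us)) with hEΛ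
  set X := ∑ i, breg D xs i (s.x i) with hX
  set W := ∑ i, breg D xs i (s.w i) with hW
  have h1 : expNoise D p.b (fun ξ => lyap D U p xs us (step D U V p s ξ))
      = (1 - p.θ₂ - p.θ₁ / 2) * EX + β * EW + P * EZ + 5 * D.Lf * EΛ := by
    simp only [lyap, expNoise_add, expNoise_const_mul, hEX, hEW, hEZ, hEΛ, hP, hβ]
  have h2 : EW = (p.b : ℝ) / n * EX + (1 - (p.b : ℝ) / n) * W := by
    rw [hEW, hEX, expNoise_sum, expNoise_sum, hW, Finset.mul_sum, Finset.mul_sum,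
      ← Finset.sum_add_distrib]
    refine Finset.sum_congr rfl fun i _ => ?_
    -- The new `x` of node `i` depends on the noise only through that node's own samples, so the
    -- coin and the other nodes can be filled in arbitrarily.
    have e1 := hD.expNoise_sample hd p.b i
      (fun S => breg D xs i ((step D U V p s (fun _ => (S, true))).x i))
    have e2 := hD.expNoise_node hd p.b i
      (fun S => breg D xs i ((step D U V p s (fun _ => (S, true))).x i))
      (fun _ => breg D xs i (s.w i))
    rw [← e1, ← Finset.sum_mul, hD.sum_prod_prob hd, one_mul] at e2
    refine Eq.trans ?_ e2
    congr 1
    funext ξ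
    rw [← apply_ite (breg D xs i)]
    rfl
  have hvar : expNoise D p.b (fun ξ => ∑ i, ‖gradErr D p s i (ξ i).1‖ ^ 2)
      ≤ 2 * D.Lbarf / p.b * ∑ i, (D.localObj i (s.w i) - D.localObj i (extrap p s i)
          - inner ℝ (gradient (D.localObj i) (extrap p s i)) (s.w i - extrap p s i)) := by
    rw [expNoise_sum, Finset.mul_sum]
    refine Finset.sum_le_sum fun i _ => ?_
    rw [hD.expNoise_sample hd p.b i (fun S => ‖gradErr D p s i S‖ ^ 2)]
    refine (hD.sum_sq_norm_vrGradient_sub_le hd hn hp.b_pos i _ _).trans ?_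
    refine mul_le_mul_of_nonneg_right ?_ ?_
    · have := D.Lbar_le_Lbarf i
      gcongr
    · have := hD.inner_gradient_le i (s.w i) (extrap p s i)
      linarith
  have hmean : expNoise D p.b (fun ξ => ∑ i, inner ℝ (gradErr D p s i (ξ i).1) (s.z i - xs)) = 0 := by
    rw [expNoise_sum]
    refine Finset.sum_eq_zero fun i _ => ?_
    rw [hD.expNoise_sample hd p.b i (fun S => inner ℝ (gradErr D p s i S) (s.z i - xs))]
    exact hD.sum_inner_vrGradient_sub hd hp.b_pos i _ _ _
  set B := ∑ i, (D.localObj i (s.w i) - D.localObj i (extrap p s i)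
          - inner ℝ (gradient (D.localObj i) (extrap p s i)) (s.w i - extrap p s i)) with hB
  have h3 := hD.expNoise_mono hd hp.b_le (step_le hD hUV hκ hp hus s hs)
  simp only [sub_eq_add_neg (_ + _ + _) , sub_eq_add_neg (_ + _), ← neg_mul, expNoise_add,
    expNoise_const_mul, hD.expNoise_const hd hm] at h3
  rw [hmean, ← hP, ← hX, ← hW, ← hB, ← hEX, ← hEZ, ← hEΛ] at h3
  -- This identity dictates `θ₂`: the variance cancels the term `-θ₂ B` exactly.
  have h4 : 1 / (4 * D.Lf) * (2 * D.Lbarf / p.b * B) = p.θ₂ * B := by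
    rw [hp.theta2_eq]; field_simp; norm_num
  have h5 := mul_le_mul_of_nonneg_left hvar (by positivity : 0 ≤ 1 / (4 * D.Lf))
  rw [h4] at h5
  have h6 : β * ((p.b : ℝ) / n) = p.θ₂ + p.θ₁ / 2 := by rw [hβ]; field_simp
  have hX0 : 0 ≤ X := Finset.sum_nonneg fun i _ => hD.breg_nonneg xs i _
  have hW0 : 0 ≤ W := Finset.sum_nonneg fun i _ => hD.breg_nonneg xs i _
  have hZ0 : 0 ≤ sqNorm (s.z - fun _ => xs) := sqNorm_nonneg _
  rw [h1, h2]
  have hlyap : lyap D U p xs us s = (1 - p.θ₂ - p.θ₁ / 2) * X + β * W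
      + P * sqNorm (s.z - fun _ => xs) + 5 * D.Lf * sqNorm (s.lam - mix U us) := rfl
  rw [hlyap]
  -- The weights in `lyap` are such that the direct and the snapshot contributions of the new `x`
  -- add up to coefficient one, as in `step_le`. A margin of `θ₁ / 2` remains on each Bregman term
  -- to pay for `ρ`.
  have hlhs : (1 - p.θ₂ - p.θ₁ / 2) * EX + β * ((p.b : ℝ) / n * EX + (1 - (p.b : ℝ) / n) * W)
      = EX + (β - (p.θ₂ + p.θ₁ / 2)) * W := by
    linear_combination (EX - W) * h6
  have g1 : (1 - p.θ₁ - p.θ₂) * X ≤ (1 - ρ) * (1 - p.θ₂ - p.θ₁ / 2) * X := by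
    refine mul_le_mul_of_nonneg_right ?_ hX0
    have h7 : 0 ≤ p.θ₂ := by
      have : 0 ≤ D.Lbarf :=
        (D.Lbar_le_Lbarf ⟨0, hm⟩).trans' (mul_nonneg (by positivity) (hD.sum_Lc_pos hd _).le)
      rw [hp.theta2_eq]; positivity
    nlinarith [hp.rho_le_theta, hp.rho_nonneg, hp.theta1_pos]
  have g2 : (β - p.θ₁ / 2) * W ≤ (1 - ρ) * β * W := by
    refine mul_le_mul_of_nonneg_right ?_ hW0
    have := hp.rho_mul
    rw [← hβ] at this
    linarith
  have g3 : 5 * D.Lf * p.θ₁ ^ 2 * sqNorm (s.z - fun _ => xs)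
      ≤ (1 - ρ) * P * sqNorm (s.z - fun _ => xs) := by
    refine mul_le_mul_of_nonneg_right ?_ hZ0
    have := hp.rho_z
    rw [← hP] at this
    linarith
  rw [hlhs]
  linarith

end Expectation

/-! ### Expectations along the random trajectory -/

section Trajectory

variable {m n d : ℕ} {D : Problem m n d}

/-- The state after `k` iterations is a function of the first `k` noise variables. -/
lemma exists_run_eq (D : Problem m n d) (U V : Matrix (Fin m) (Fin m) ℝ) (p : Params)
    (x₀ : Stacked m d) (k : ℕ) :
    ∃ R : (Fin k → Noise m n p.b) → State m d,
      ∀ ξ : ℕ → Noise m n p.b, run D U V p x₀ ξ k = R fun t => ξ t := by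
  induction k with
  | zero => exact ⟨fun _ => initState n x₀, fun _ => rfl⟩
  | succ k ih =>
    obtain ⟨R, hR⟩ := ih
    refine ⟨fun h => step D U V p (R fun t => h t.castSucc) (h (Fin.last k)), fun ξ => ?_⟩
    rw [run, hR]
    rfl

/-- The multiplier starts at zero and moves only by images of `U`; staying in the range is what
makes the lower bound on `U` usable. -/
lemma exists_run_lam_eq (D : Problem m n d) (U V : Matrix (Fin m) (Fin m) ℝ) (p : Params)
    (x₀ : Stacked m d) (ξ : ℕ → Noise m n p.b) (k : ℕ) :
    ∃ u, (run D U V p x₀ ξ k).lam = mix U u := by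
  induction k with
  | zero =>
    refine ⟨0, ?_⟩
    funext i
    simp [run, initState, mix]
  | succ k ih =>
    obtain ⟨u, hu⟩ := ih
    refine ⟨u + p.θ₁ • (run D U V p x₀ ξ (k + 1)).z, ?_⟩
    have h1 : (run D U V p x₀ ξ (k + 1)).lam = fun i => (run D U V p x₀ ξ k).lam i
      + p.θ₁ • mix U (run D U V p x₀ ξ (k + 1)).z i := rfl
    rw [h1, hu]
    funext i
    simp [mix, Finset.sum_add_distrib, Finset.smul_sum, smul_comm p.θ₁]

lemma run_comm (D : Problem m n d) (U V : Matrix (Fin m) (Fin m) ℝ) (p : Params)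
    (x₀ : Stacked m d) (ξ : ℕ → Noise m n p.b) (k : ℕ) : (run D U V p x₀ ξ k).comm = k := by
  induction k with
  | zero => rfl
  | succ k ih =>
    have : (run D U V p x₀ ξ (k + 1)).comm = (run D U V p x₀ ξ k).comm + 1 := rfl
    rw [this, ih]

variable {b : ℕ} {Ω : Type*} [MeasurableSpace Ω] {P : Measure Ω}
  {ξ : ℕ → Ω → Noise m n b}

lemma IsSampling.measurable_history (h : IsSampling D P ξ) (k : ℕ) :
    Measurable fun ω (t : Fin k) => ξ t ω :=
  measurable_pi_lambda _ fun t => h.measurable t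

lemma IsSampling.indepFun_history (h : IsSampling D P ξ) (k : ℕ) :
    IndepFun (fun ω (t : Fin k) => ξ t ω) (ξ k) P := by
  have h1 := h.indep.indepFun_finset (Finset.range k) {k} (by simp) h.measurable
  have h2 : Measurable fun (a : Finset.range k → Noise m n b) (t : Fin k) =>
      a ⟨t, Finset.mem_range.2 t.2⟩ := measurable_of_finite _
  have h3 : Measurable fun a : ({k} : Finset ℕ) → Noise m n b =>
      a ⟨k, Finset.mem_singleton_self k⟩ := measurable_of_finite _
  exact h1.comp h2 h3

variable [IsProbabilityMeasure P]

lemma integrable_comp_of_finite {T : Type*} [Finite T] [MeasurableSpace T]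
    [MeasurableSingletonClass T] {X : Ω → T} (hX : Measurable X) (φ : T → ℝ) :
    Integrable (fun ω => φ (X ω)) P :=
  (Integrable.of_finite (μ := P.map X) (f := φ)).comp_measurable hX

lemma IsSampling.integrable_history (h : IsSampling D P ξ) (k : ℕ)
    (φ : (Fin k → Noise m n b) → ℝ) : Integrable (fun ω => φ fun t => ξ t ω) P :=
  integrable_comp_of_finite (h.measurable_history k) φ

/-- Averaging over the noise of iteration `k`, which is independent of the past. -/
lemma IsSampling.integral_history_eq (h : IsSampling D P ξ) (k : ℕ)
    (Ψ : (Fin k → Noise m n b) → Noise m n b → ℝ) :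
    ∫ ω, Ψ (fun t => ξ t ω) (ξ k ω) ∂P = ∫ ω, expNoise D b (Ψ fun t => ξ t ω) ∂P := by
  classical
  -- The noise takes finitely many values, so no conditional expectation is needed: each summand is
  -- a function of the past times an independent indicator.
  have h1 : ∀ ω, Ψ (fun t => ξ t ω) (ξ k ω)
      = ∑ s, Ψ (fun t => ξ t ω) s * (if ξ k ω = s then 1 else 0) := by
    intro ω
    simp
  simp_rw [h1, expNoise]
  rw [integral_finsetSum, integral_finsetSum]
  · refine Finset.sum_congr rfl fun s _ => ?_
    have h2 : IndepFun (fun ω => Ψ (fun t => ξ t ω) s) (fun ω => if ξ k ω = s then (1 : ℝ) else 0) P :=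
      (h.indepFun_history k).comp (φ := fun a => Ψ a s) (ψ := fun a => if a = s then (1 : ℝ) else 0)
        (measurable_of_finite _) (measurable_of_finite _)
    rw [h2.integral_fun_mul_eq_mul_integral (h.integrable_history k fun a => Ψ a s).aestronglyMeasurable
      (integrable_comp_of_finite (h.measurable k)
        fun a => if a = s then (1 : ℝ) else 0).aestronglyMeasurable,
      integral_const_mul, mul_comm]
    congr 1
    rw [← h.law k s]
    have h3 : (fun ω => if ξ k ω = s then (1 : ℝ) else 0)
        = Set.indicator {ω | ξ k ω = s} (fun _ => 1) := by
      funext ω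
      simp [Set.indicator_apply]
    have h4 : MeasurableSet {ω | ξ k ω = s} := h.measurable k (measurableSet_singleton s)
    rw [h3, integral_indicator_const _ h4]
    simp
  · exact fun s _ => h.integrable_history k fun a => noiseWeight D b s * Ψ a s
  · intro s _
    exact integrable_comp_of_finite ((h.measurable_history k).prodMk (h.measurable k))
      (fun a => Ψ a.1 s * if a.2 = s then 1 else 0)

/-- The history takes finitely many values, so any function of the state is integrable and no
measurable structure on `State` is required. -/
lemma IsSampling.integrable_run {p : Params} {ξ : ℕ → Ω → Noise m n p.b} (h : IsSampling D P ξ)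
    (U V : Matrix (Fin m) (Fin m) ℝ) (x₀ : Stacked m d) (k : ℕ) (φ : State m d → ℝ) :
    Integrable (fun ω => φ (run D U V p x₀ (fun t => ξ t ω) k)) P := by
  obtain ⟨R, hR⟩ := exists_run_eq D U V p x₀ k
  simp_rw [hR]
  exact h.integrable_history k fun a => φ (R a)

lemma IsSampling.integral_run_succ {p : Params} {ξ : ℕ → Ω → Noise m n p.b}
    (h : IsSampling D P ξ) (U V : Matrix (Fin m) (Fin m) ℝ) (x₀ : Stacked m d) (k : ℕ)
    (φ : State m d → Noise m n p.b → ℝ) :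
    ∫ ω, φ (run D U V p x₀ (fun t => ξ t ω) k) (ξ k ω) ∂P
      = ∫ ω, expNoise D p.b (φ (run D U V p x₀ (fun t => ξ t ω) k)) ∂P := by
  obtain ⟨R, hR⟩ := exists_run_eq D U V p x₀ k
  simp_rw [hR]
  exact h.integral_history_eq k fun a => φ (R a)

/-- The expected number of component gradients evaluated by node `i`. -/
lemma IsSampling.integral_evals {p : Params} {ξ : ℕ → Ω → Noise m n p.b}
    (h : IsSampling D P ξ) (hD : D.Regular) (hm : 0 < m) (hn : 0 < n) (hd : 0 < d)
    (U V : Matrix (Fin m) (Fin m) ℝ) (x₀ : Stacked m d) (i : Fin m) (k : ℕ) :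
    ∫ ω, ((run D U V p x₀ (fun t => ξ t ω) k).evals i : ℝ) ∂P = n + 3 * p.b * k := by
  have hn' : (n : ℝ) ≠ 0 := by exact_mod_cast hn.ne'
  induction k with
  | zero => simp [run, initState]
  | succ k ih =>
    have h1 : ∀ ω, ((run D U V p x₀ (fun t => ξ t ω) (k + 1)).evals i : ℝ)
        = (run D U V p x₀ (fun t => ξ t ω) k).evals i + 2 * p.b
          + (if (ξ k ω i).2 then (n : ℝ) else 0) := by
      intro ω
      simp [run, step]
    simp_rw [h1]
    rw [h.integral_run_succ U V x₀ k
      (fun s ξ => (s.evals i : ℝ) + 2 * p.b + (if (ξ i).2 then (n : ℝ) else 0))]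
    have h2 : ∀ s : State m d, expNoise D p.b
        (fun ξ => (s.evals i : ℝ) + 2 * p.b + (if (ξ i).2 then (n : ℝ) else 0))
        = s.evals i + 3 * p.b := by
      intro s
      have := hD.expNoise_node hd p.b i (fun _ => (n : ℝ)) (fun _ => 0)
      rw [expNoise_add, hD.expNoise_const hd hm, this]
      simp only [mul_zero, Finset.sum_const_zero, add_zero, ← Finset.sum_mul,
        hD.sum_prod_prob hd, one_mul]
      rw [div_mul_cancel₀ _ hn']
      ring
    simp_rw [h2]
    rw [integral_add (h.integrable_run U V x₀ k fun s => (s.evals i : ℝ)) (integrable_const _), ih]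
    simp
    ring

/-- Linear convergence of the Lyapunov function in expectation. -/
lemma IsSampling.integral_lyap_le {p : Params} {ξ : ℕ → Ω → Noise m n p.b}
    (h : IsSampling D P ξ) (hD : D.Regular) (hm : 0 < m) (hn : 0 < n) (hd : 0 < d)
    {U V : Matrix (Fin m) (Fin m) ℝ} {κ ρ : ℝ} (hUV : MixingPair d U V κ) (hκ : 0 < κ)
    (hp : Admissible D p κ ρ) {xs : Vec d} {us : Stacked m d}
    (hus : ∀ i, gradient (D.localObj i) xs = -((10 * D.Lf) • mix U (mix U us) i))
    (x₀ : Stacked m d) (k : ℕ) :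
    ∫ ω, lyap D U p xs us (run D U V p x₀ (fun t => ξ t ω) k) ∂P
      ≤ (1 - ρ) ^ k * lyap D U p xs us (initState n x₀) := by
  induction k with
  | zero => simp [run]
  | succ k ih =>
    have h1 := h.integral_run_succ U V x₀ k (fun s ξ => lyap D U p xs us (step D U V p s ξ))
    have h2 : ∫ ω, expNoise D p.b (fun ζ => lyap D U p xs us
        (step D U V p (run D U V p x₀ (fun t => ξ t ω) k) ζ)) ∂P
        ≤ ∫ ω, (1 - ρ) * lyap D U p xs us (run D U V p x₀ (fun t => ξ t ω) k) ∂P := by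
      refine integral_mono
        (h.integrable_run U V x₀ k fun s => expNoise D p.b fun ζ => lyap D U p xs us
          (step D U V p s ζ))
        (h.integrable_run U V x₀ k fun s => (1 - ρ) * lyap D U p xs us s) fun ω => ?_
      exact expNoise_lyap_step_le hD hm hn hd hUV hκ hp hus _ (exists_run_lam_eq D U V p x₀ _ k)
    rw [integral_const_mul] at h2
    have h3 := mul_le_mul_of_nonneg_left ih (by linarith [hp.rho_le] : 0 ≤ 1 - ρ)
    rw [← mul_assoc, ← pow_succ'] at h3
    exact h1.le.trans (h2.trans h3)

end Trajectory

/-! ### Dual solution, admissibility of the parameters, and the rate -/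

section Parameters

variable {m n d : ℕ} {D : Problem m n d}

/-- The gradients of the local objectives at a minimizer of their sum add up to zero. -/
lemma Problem.Regular.sum_gradient_eq_zero (hD : D.Regular) {xs : Vec d}
    (hxs : ∀ x, D.objective xs ≤ D.objective x) : ∑ i, gradient (D.localObj i) xs = 0 := by
  have h1 : HasFDerivAt D.objective
      (∑ i, InnerProductSpace.toDual ℝ (Vec d) (gradient (D.localObj i) xs)) xs := by
    unfold Problem.objective
    refine HasFDerivAt.fun_sum fun i _ => ?_
    exact hasGradientAt_iff_hasFDerivAt.1 (hD.differentiable_localObj i xs).hasGradientAt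
  have h2 : IsLocalMin D.objective xs := Filter.Eventually.of_forall hxs
  have h3 := h2.hasFDerivAt_eq_zero h1
  rw [← map_sum] at h3
  exact (LinearIsometryEquiv.map_eq_zero_iff _).1 h3

/-- The dual solution. -/
lemma Problem.Regular.exists_dual (hD : D.Regular) (hL : 0 < D.Lf) {xs : Vec d}
    (hxs : ∀ x, D.objective xs ≤ D.objective x) {U V : Matrix (Fin m) (Fin m) ℝ} {κ : ℝ}
    (hκ : 0 < κ) (hUV : MixingPair d U V κ) :
    ∃ us : Stacked m d,
      (∀ i, gradient (D.localObj i) xs = -((10 * D.Lf) • mix U (mix U us) i)) ∧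
      sqNorm (mix U us) ≤ κ / (100 * D.Lf ^ 2) * ∑ i, ‖gradient (D.localObj i) xs‖ ^ 2 := by
  obtain ⟨us, hus⟩ := exists_mix_mix_eq hUV
    (fun i => -((1 / (10 * D.Lf)) • gradient (D.localObj i) xs)) (by
      rw [Finset.sum_neg_distrib, ← Finset.smul_sum, hD.sum_gradient_eq_zero hxs, smul_zero,
        neg_zero])
  refine ⟨us, fun i => ?_, ?_⟩
  · rw [hus, smul_neg, neg_neg, smul_smul, mul_one_div_cancel (by positivity), one_smul]
  · have h1 := hUV.U_ge (mix U us) ⟨_, rfl⟩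
    rw [one_div, inv_mul_le_iff₀ hκ, hus] at h1
    refine h1.trans (le_of_eq ?_)
    simp only [sqNorm, norm_neg, norm_smul, mul_pow, Real.norm_eq_abs, sq_abs]
    rw [← Finset.mul_sum]
    field_simp
    ring

/-- The mini-batch size squared dominates the quantity under the root. -/
lemma le_sq_batchSize {κ : ℝ} : (n : ℝ) * max D.Lbarf (n * D.μ) / (κ * D.Lf) ≤
    (batchSize D κ : ℝ) ^ 2 := by
  have h1 : Real.sqrt (n * max D.Lbarf (n * D.μ) / (κ * D.Lf)) ≤ batchSize D κ := Nat.le_ceil _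
  exact (Real.sqrt_le_left (Nat.cast_nonneg _)).1 h1

/-- The standing assumptions on `κ`. -/
structure Range (D : Problem m n d) (κ : ℝ) : Prop where
  mu_pos : 0 < D.μ
  Lf_le : D.Lf ≤ D.Lbarf
  one_le : 1 ≤ κ
  le_kappaB : κ ≤ D.kappaB
  le_max : κ ≤ max (n * D.kappaB / D.kappaS) (n ^ 2 * D.kappaB / D.kappaS ^ 2)

namespace Range

variable {κ : ℝ}

lemma kappa_pos (h : Range D κ) : 0 < κ := one_pos.trans_le h.one_le

lemma kappa_mul_mu_le (h : Range D κ) : κ * D.μ ≤ D.Lf := (le_div_iff₀ h.mu_pos).1 h.le_kappaB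

lemma mu_le (h : Range D κ) : D.μ ≤ D.Lf := by
  have := h.kappa_mul_mu_le
  nlinarith [h.one_le, h.mu_pos]

lemma Lf_pos (h : Range D κ) : 0 < D.Lf := h.mu_pos.trans_le h.mu_le

lemma Lbarf_pos (h : Range D κ) : 0 < D.Lbarf := h.Lf_pos.trans_le h.Lf_le

/-- The two entries of the maximum, cleared of denominators. Each later use pairs an alternative
with its own argument. -/
lemma cases (h : Range D κ) :
    κ * D.Lbarf ≤ n * D.Lf ∨ κ * D.Lbarf ^ 2 ≤ (n : ℝ) ^ 2 * (D.Lf * D.μ) := by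
  have hμ := h.mu_pos
  have hS := h.Lbarf_pos
  rcases le_max_iff.1 h.le_max with h1 | h1
  · left
    have : n * D.kappaB / D.kappaS = n * D.Lf / D.Lbarf := by
      rw [Problem.kappaB, Problem.kappaS]; field_simp
    rw [this, le_div_iff₀ hS] at h1
    exact h1
  · right
    have : (n : ℝ) ^ 2 * D.kappaB / D.kappaS ^ 2 = n ^ 2 * (D.Lf * D.μ) / D.Lbarf ^ 2 := by
      rw [Problem.kappaB, Problem.kappaS]; field_simp
    rw [this, le_div_iff₀ (by positivity)] at h1
    exact h1

/-- Not assumed, since the `Lᵢⱼ` are arbitrary valid constants: it follows from either bound on `κ`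
because `κ ≥ 1` (and `μ ≤ L_f` in the second case). It yields `b ≤ n`, so that `b / n` is a
probability. -/
lemma Lbarf_le (h : Range D κ) : D.Lbarf ≤ n * D.Lf := by
  have hS := h.Lbarf_pos
  have hL := h.Lf_pos
  rcases h.cases with h1 | h1
  · nlinarith [h.one_le]
  · refine le_of_sq_le_sq ?_ (by positivity)
    have h2 : D.Lf * D.μ ≤ D.Lf ^ 2 := by nlinarith [h.mu_le]
    have h3 : (n : ℝ) ^ 2 * (D.Lf * D.μ) ≤ n ^ 2 * D.Lf ^ 2 := by gcongr
    nlinarith [h.one_le, sq_nonneg D.Lbarf]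

lemma batchSize_pos (h : Range D κ) (hn : 0 < n) : 0 < batchSize D κ := by
  have hL := h.Lf_pos
  have hκ := h.kappa_pos
  have hS : 0 < max D.Lbarf (n * D.μ) := lt_max_of_lt_left h.Lbarf_pos
  have hn' : (0 : ℝ) < n := by exact_mod_cast hn
  exact Nat.ceil_pos.2 (Real.sqrt_pos.2 (by positivity))

lemma batchSize_le (h : Range D κ) : batchSize D κ ≤ n := by
  have hL := h.Lf_pos
  have hκ := h.kappa_pos
  refine Nat.ceil_le.2 ((Real.sqrt_le_left (Nat.cast_nonneg _)).2 ?_)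
  rw [div_le_iff₀ (by positivity)]
  have h1 : max D.Lbarf (n * D.μ) ≤ n * (κ * D.Lf) := by
    have h2 : D.Lf ≤ κ * D.Lf := le_mul_of_one_le_left hL.le h.one_le
    refine max_le (h.Lbarf_le.trans ?_) ?_
    · gcongr
    · have := h.mu_le.trans h2
      gcongr
  calc (n : ℝ) * max D.Lbarf (n * D.μ) ≤ n * (n * (κ * D.Lf)) := by gcongr
    _ = _ := by ring

lemma le_sq_batchSize_left (h : Range D κ) :
    n * D.Lbarf ≤ κ * D.Lf * (batchSize D κ : ℝ) ^ 2 := by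
  have h1 := le_sq_batchSize (D := D) (κ := κ)
  rw [div_le_iff₀' (mul_pos h.kappa_pos h.Lf_pos)] at h1
  refine le_trans ?_ h1
  gcongr
  exact le_max_left _ _

lemma le_sq_batchSize_right (h : Range D κ) :
    (n : ℝ) ^ 2 * D.μ ≤ κ * D.Lf * (batchSize D κ : ℝ) ^ 2 := by
  have h1 := le_sq_batchSize (D := D) (κ := κ)
  rw [div_le_iff₀' (mul_pos h.kappa_pos h.Lf_pos)] at h1
  refine le_trans ?_ h1
  rw [sq, mul_assoc]
  gcongr
  exact le_max_right _ _

lemma theta2_le (h : Range D κ) (hn : 0 < n) : (accParams D κ).θ₂ ≤ 1 / 2 := by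
  have hL := h.Lf_pos
  have hS := h.Lbarf_pos
  have hκ := h.kappa_pos
  have hb : (0 : ℝ) < batchSize D κ := by exact_mod_cast h.batchSize_pos hn
  -- Each upper bound on `κ` meets the matching lower bound on `b²`: the entry `L̄_f` of the maximum
  -- defining `b` for the first, `n μ` for the second.
  have key : D.Lbarf ≤ D.Lf * batchSize D κ := by
    refine le_of_sq_le_sq ?_ (by positivity)
    refine le_of_mul_le_mul_left ?_ hκ
    rcases h.cases with h1 | h1
    · have h2 := h.le_sq_batchSize_left
      nlinarith [mul_le_mul_of_nonneg_left h2 hL.le, mul_le_mul_of_nonneg_left h1 hS.le]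
    · have h2 := h.le_sq_batchSize_right
      nlinarith [mul_le_mul_of_nonneg_left h2 hL.le]
  simp only [accParams]
  rw [div_le_iff₀ (by positivity)]
  linarith

lemma sqrt_pos (h : Range D κ) : 0 < Real.sqrt (κ * D.μ / D.Lf) :=
  Real.sqrt_pos.2 (div_pos (mul_pos h.kappa_pos h.mu_pos) h.Lf_pos)

lemma theta1_pos (h : Range D κ) : 0 < (accParams D κ).θ₁ :=
  mul_pos (by norm_num) h.sqrt_pos

lemma theta1_le (h : Range D κ) : (accParams D κ).θ₁ ≤ 1 / 2 := by
  have : Real.sqrt (κ * D.μ / D.Lf) ≤ 1 :=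
    Real.sqrt_le_one.2 ((div_le_one h.Lf_pos).2 h.kappa_mul_mu_le)
  simp only [accParams]
  linarith

lemma Lf_mul_sq_theta1 (h : Range D κ) : 4 * D.Lf * (accParams D κ).θ₁ ^ 2 = κ * D.μ := by
  have hL := h.Lf_pos
  simp only [accParams]
  rw [mul_pow, Real.sq_sqrt (div_pos (mul_pos h.kappa_pos h.mu_pos) hL).le]
  field_simp
  norm_num

/-- The weight of the snapshot term in the Lyapunov function. -/
lemma snapshot_weight_le (h : Range D κ) (hn : 0 < n) :
    (n : ℝ) / (accParams D κ).b * ((accParams D κ).θ₂ + (accParams D κ).θ₁ / 2) ≤ κ := by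
  have hL := h.Lf_pos
  have hS := h.Lbarf_pos
  have hκ := h.kappa_pos
  have hθ := h.theta1_pos
  have hb : (0 : ℝ) < batchSize D κ := by exact_mod_cast h.batchSize_pos hn
  have h1 : (n : ℝ) / batchSize D κ * (accParams D κ).θ₂ ≤ κ / 2 := by
    have : (n : ℝ) / batchSize D κ * (accParams D κ).θ₂
        = n * D.Lbarf / (D.Lf * (batchSize D κ : ℝ) ^ 2) / 2 := by
      simp only [accParams]; field_simp
    rw [this]
    gcongr
    rw [div_le_iff₀ (by positivity), ← mul_assoc]
    exact h.le_sq_batchSize_left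
  have h2 : (n : ℝ) / batchSize D κ * ((accParams D κ).θ₁ / 2) ≤ κ / 4 := by
    rw [div_mul_eq_mul_div, div_le_iff₀ hb]
    have h3 : n * (2 * (accParams D κ).θ₁) ≤ κ * batchSize D κ := by
      refine le_of_sq_le_sq ?_ (by positivity)
      have h4 := h.Lf_mul_sq_theta1
      have h5 := h.le_sq_batchSize_right
      refine le_of_mul_le_mul_left ?_ hL
      calc D.Lf * (n * (2 * (accParams D κ).θ₁)) ^ 2
          = n ^ 2 * (4 * D.Lf * (accParams D κ).θ₁ ^ 2) := by ring
        _ = κ * (n ^ 2 * D.μ) := by rw [h4]; ring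
        _ ≤ κ * (κ * D.Lf * (batchSize D κ : ℝ) ^ 2) := by gcongr
        _ = _ := by ring
    linarith
  rw [mul_add]
  have h3 : (accParams D κ).b = batchSize D κ := rfl
  rw [h3]
  linarith

/-- The dual condition `ρ κ ≤ θ₁ / 30` holds with equality and determines the rate. The other
conditions have room, as the snapshot weight is at most `κ` and `5 L_f θ₁² = 5 κ μ / 4`. -/
lemma admissible (h : Range D κ) (hn : 0 < n) :
    Admissible D (accParams D κ) κ ((accParams D κ).θ₁ / (30 * κ)) := by
  have hL := h.Lf_pos
  have hμ := h.mu_pos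
  have hκ := h.kappa_pos
  have hκ1 := h.one_le
  have hθ := h.theta1_pos
  have hρ : (accParams D κ).θ₁ / (30 * κ) ≤ (accParams D κ).θ₁ / 30 := by
    gcongr; linarith
  refine ⟨h.mu_le, rfl, hθ, h.theta1_le, h.theta2_le hn, rfl, h.batchSize_pos hn, h.batchSize_le,
    by positivity, ?_, le_of_eq ?_, ?_, ?_, ?_⟩
  · linarith [h.theta1_le]
  · field_simp
  · linarith
  · refine (mul_le_mul_of_nonneg_left (h.snapshot_weight_le hn) (by positivity)).trans ?_
    rw [div_mul_eq_mul_div, div_le_div_iff₀ (by positivity) (by positivity)]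
    nlinarith [mul_pos hθ hκ]
  · have h1 : 5 * D.Lf * (accParams D κ).θ₁ ^ 2 = 5 / 4 * (κ * D.μ) := by
      rw [← h.Lf_mul_sq_theta1]; ring
    rw [h1, div_mul_eq_mul_div, div_le_iff₀ (by positivity)]
    have h2 : (accParams D κ).θ₁ * D.μ / 4 ≤ κ * D.μ := by
      nlinarith [h.theta1_le, mul_le_mul_of_nonneg_right hκ1 hμ.le]
    nlinarith [mul_pos hθ (mul_pos hκ hμ), mul_le_mul_of_nonneg_left h2 hθ.le]

/-- The contraction factor in terms of the condition numbers. -/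
lemma inv_rate (h : Range D κ) :
    1 / ((accParams D κ).θ₁ / (30 * κ)) = 60 * Real.sqrt (D.kappaB * κ) := by
  have hL := h.Lf_pos
  have hμ := h.mu_pos
  have hκ := h.kappa_pos
  have h1 : Real.sqrt (D.kappaB * κ) * Real.sqrt (κ * D.μ / D.Lf) = κ := by
    rw [← Real.sqrt_mul (mul_nonneg (hκ.le.trans h.le_kappaB) hκ.le), Problem.kappaB]
    have : D.Lf / D.μ * κ * (κ * D.μ / D.Lf) = κ ^ 2 := by field_simp
    rw [this, Real.sqrt_sq hκ.le]
  have h2 := h.sqrt_pos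
  simp only [accParams]
  rw [one_div, inv_div, div_eq_iff (by positivity)]
  linarith

lemma one_le_sqrt (h : Range D κ) : 1 ≤ Real.sqrt (D.kappaB * κ) := by
  refine Real.one_le_sqrt.2 ?_
  nlinarith [h.le_kappaB, h.one_le]

/-- Bounds the price of rounding `b` up to an integer: the first alternative on `κ` gives `κ_b κ ≤ n
κ_s`, the second `κ_b κ ≤ n²`. -/
lemma sqrt_kappa_le (h : Range D κ) :
    Real.sqrt (D.kappaB * κ) ≤ Real.sqrt (n * D.kappaS) + n := by
  have hL := h.Lf_pos
  have hμ := h.mu_pos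
  have hS := h.Lbarf_pos
  have hκs : 0 ≤ D.kappaS := div_nonneg hS.le hμ.le
  have hB : D.kappaB = D.Lf / D.μ := rfl
  rcases h.cases with h1 | h1
  · refine (Real.sqrt_le_sqrt ?_).trans (le_add_of_nonneg_right (Nat.cast_nonneg n))
    have h2 : D.Lf * κ ≤ n * D.Lbarf := by
      have h3 : κ * D.Lf ≤ κ * D.Lbarf := mul_le_mul_of_nonneg_left h.Lf_le h.kappa_pos.le
      have h4 : (n : ℝ) * D.Lf ≤ n * D.Lbarf := by gcongr; exact h.Lf_le
      linarith
    rw [Problem.kappaB, Problem.kappaS, div_mul_eq_mul_div, ← mul_div_assoc]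
    gcongr
  · refine le_trans ?_ (le_add_of_nonneg_left (Real.sqrt_nonneg _))
    refine (Real.sqrt_le_left (Nat.cast_nonneg _)).2 ?_
    rw [Problem.kappaB, div_mul_eq_mul_div, div_le_iff₀ hμ]
    have h2 : κ * D.Lf ^ 2 ≤ κ * D.Lbarf ^ 2 := by
      have := h.kappa_pos
      gcongr
      exact h.Lf_le
    nlinarith

lemma batchSize_mul_sqrt_le (h : Range D κ) :
    batchSize D κ * Real.sqrt (D.kappaB * κ) ≤ 2 * (Real.sqrt (n * D.kappaS) + n) := by
  have hL := h.Lf_pos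
  have hμ := h.mu_pos
  have hκ := h.kappa_pos
  have hS := h.Lbarf_pos
  set M := (n : ℝ) * max D.Lbarf (n * D.μ) / (κ * D.Lf) with hM
  have hM0 : 0 ≤ M := by
    have : 0 ≤ max D.Lbarf (n * D.μ) := le_max_of_le_left hS.le
    positivity
  have h1 : (batchSize D κ : ℝ) ≤ Real.sqrt M + 1 := (Nat.ceil_lt_add_one (Real.sqrt_nonneg _)).le
  have h2 : Real.sqrt M * Real.sqrt (D.kappaB * κ) ≤ Real.sqrt (n * D.kappaS) + n := by
    rw [← Real.sqrt_mul hM0]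
    have h3 : M * (D.kappaB * κ) = n * max D.Lbarf (n * D.μ) / D.μ := by
      rw [hM, Problem.kappaB]; field_simp
    rw [h3]
    rcases max_cases D.Lbarf (n * D.μ) with ⟨h4, -⟩ | ⟨h4, -⟩
    · rw [h4, mul_div_assoc]
      exact le_add_of_nonneg_right (Nat.cast_nonneg n)
    · have h5 : (n : ℝ) * (n * D.μ) / D.μ = (n : ℝ) ^ 2 := by field_simp
      rw [h4, h5, Real.sqrt_sq (Nat.cast_nonneg n)]
      exact le_add_of_nonneg_left (Real.sqrt_nonneg _)
  have h3 := mul_le_mul_of_nonneg_right h1 (Real.sqrt_nonneg (D.kappaB * κ))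
  have h4 := h.sqrt_kappa_le
  linarith

end Range

/-- The constant in the bound for the distance to the solution. -/
def initConst (D : Problem m n d) (xs : Vec d) (x₀ : Stacked m d) : ℝ :=
  4 / (5 * D.μ) * (2 * ∑ i, breg D xs i (x₀ i) + 2 * D.μ * sqNorm (x₀ - fun _ => xs)
    + 1 / (20 * D.Lf) * ∑ i, ‖gradient (D.localObj i) xs‖ ^ 2)

/-- The weight of `‖z - x*‖²` in `lyap` is at least `5 κ μ / 4`, while the initial value, dual part
included, is at most proportional to `κ`. The factor `κ` cancels, so `initConst` is independent of
`U`, `V` and `κ`. -/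
lemma IsSampling.integral_sqNorm_le (hD : D.Regular) (hm : 0 < m) (hn : 0 < n) (hd : 0 < d)
    {κ : ℝ} (h : Range D κ) {Ω : Type*} [MeasurableSpace Ω] {P : Measure Ω}
    [IsProbabilityMeasure P] {ξ : ℕ → Ω → Noise m n (accParams D κ).b} (hξ : IsSampling D P ξ)
    {U V : Matrix (Fin m) (Fin m) ℝ} (hUV : MixingPair d U V κ) {xs : Vec d}
    (hxs : ∀ x, D.objective xs ≤ D.objective x) (x₀ : Stacked m d) (k : ℕ) :
    ∫ ω, sqNorm ((run D U V (accParams D κ) x₀ (fun t => ξ t ω) k).z - fun _ => xs) ∂P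
      ≤ (1 - (accParams D κ).θ₁ / (30 * κ)) ^ k * initConst D xs x₀ := by
  have hL := h.Lf_pos
  have hμ := h.mu_pos
  have hκ := h.kappa_pos
  have hκ1 := h.one_le
  have hp := h.admissible hn
  obtain ⟨us, hus, hus2⟩ := hD.exists_dual hL hxs hκ hUV
  have h1 := hξ.integral_lyap_le hD hm hn hd hUV hκ hp hus x₀ k
  have hβ := h.snapshot_weight_le hn
  set p := accParams D κ with hp_def
  set ρ := p.θ₁ / (30 * κ) with hρ
  have e1 : 5 * D.Lf * p.θ₁ ^ 2 = 5 / 4 * (κ * D.μ) := by rw [← h.Lf_mul_sq_theta1]; ring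
  have hθ := hp.theta1_pos
  have hθ2 : 0 ≤ p.θ₂ := by
    have := h.Lbarf_pos
    rw [hp.theta2_eq]; positivity
  have hbreg : ∀ x : Stacked m d, 0 ≤ ∑ i, breg D xs i (x i) := fun x =>
    Finset.sum_nonneg fun i _ => hD.breg_nonneg xs i _
  have h2 : ∀ s : State m d,
      5 / 4 * (κ * D.μ) * sqNorm (s.z - fun _ => xs) ≤ lyap D U p xs us s := by
    intro s
    have g1 : 0 ≤ (1 - p.θ₂ - p.θ₁ / 2) * ∑ i, breg D xs i (s.x i) :=
      mul_nonneg (by linarith [hp.theta1_le, hp.theta2_le]) (hbreg _)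
    have g2 : 0 ≤ n / p.b * (p.θ₂ + p.θ₁ / 2) * ∑ i, breg D xs i (s.w i) :=
      mul_nonneg (by positivity) (hbreg _)
    have g3 : 0 ≤ p.θ₁ * D.μ / 4 * sqNorm (s.z - fun _ => xs) :=
      mul_nonneg (by positivity) (sqNorm_nonneg _)
    have g4 : 0 ≤ 5 * D.Lf * sqNorm (s.lam - mix U us) :=
      mul_nonneg (by positivity) (sqNorm_nonneg _)
    rw [lyap, e1]
    linarith
  have h3 : lyap D U p xs us (initState n x₀) ≤ 5 / 4 * (κ * D.μ) * initConst D xs x₀ := by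
    have hB := hbreg x₀
    have hZ := sqNorm_nonneg (x₀ - fun _ => xs)
    have hG : 0 ≤ ∑ i, ‖gradient (D.localObj i) xs‖ ^ 2 := Finset.sum_nonneg fun _ _ => sq_nonneg _
    have g0 : lyap D U p xs us (initState n x₀)
        = (1 - p.θ₂ - p.θ₁ / 2) * ∑ i, breg D xs i (x₀ i)
          + n / p.b * (p.θ₂ + p.θ₁ / 2) * ∑ i, breg D xs i (x₀ i)
          + (5 / 4 * (κ * D.μ) + p.θ₁ * D.μ / 4) * sqNorm (x₀ - fun _ => xs)
          + 5 * D.Lf * sqNorm (mix U us) := by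
      rw [lyap, e1]
      simp [initState, sqNorm]
    have g1 : 5 / 4 * (κ * D.μ) * initConst D xs x₀ = κ * (2 * ∑ i, breg D xs i (x₀ i)
        + 2 * D.μ * sqNorm (x₀ - fun _ => xs)
        + 1 / (20 * D.Lf) * ∑ i, ‖gradient (D.localObj i) xs‖ ^ 2) := by
      rw [initConst]; field_simp
    have g2 : (1 - p.θ₂ - p.θ₁ / 2) * ∑ i, breg D xs i (x₀ i) ≤ κ * ∑ i, breg D xs i (x₀ i) :=
      mul_le_mul_of_nonneg_right (by linarith) hB
    have g3 := mul_le_mul_of_nonneg_right hβ hB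
    have g4 : (5 / 4 * (κ * D.μ) + p.θ₁ * D.μ / 4) * sqNorm (x₀ - fun _ => xs)
        ≤ κ * (2 * D.μ) * sqNorm (x₀ - fun _ => xs) := by
      refine mul_le_mul_of_nonneg_right ?_ hZ
      nlinarith [hp.theta1_le, mul_le_mul_of_nonneg_right hκ1 hμ.le]
    have g5 := mul_le_mul_of_nonneg_left hus2 (by positivity : 0 ≤ 5 * D.Lf)
    have g6 : 5 * D.Lf * (κ / (100 * D.Lf ^ 2) * ∑ i, ‖gradient (D.localObj i) xs‖ ^ 2)
        = κ * (1 / (20 * D.Lf) * ∑ i, ‖gradient (D.localObj i) xs‖ ^ 2) := by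
      field_simp; ring
    rw [g0, g1]
    linarith
  have h4 := integral_mono
    (hξ.integrable_run U V x₀ k fun s => 5 / 4 * (κ * D.μ) * sqNorm (s.z - fun _ => xs))
    (hξ.integrable_run U V x₀ k fun s => lyap D U p xs us s) fun ω => h2 _
  rw [integral_const_mul] at h4
  have hρ1 : 0 ≤ (1 - ρ) ^ k := pow_nonneg (by linarith [hp.rho_le]) k
  have h5 := mul_le_mul_of_nonneg_left h3 hρ1
  refine le_of_mul_le_mul_left ?_ (by positivity : 0 < 5 / 4 * (κ * D.μ))
  linarith

end Parameters

end DecentralizedVR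

end

/-! ### Iteration count and accuracy threshold -/

open MeasureTheory ProbabilityTheory DecentralizedVR in
theorem mainTheorem2 :
    ∃ C : ℝ, 0 < C ∧
      ∀ (m n d : ℕ), 0 < m → 0 < n → 0 < d →
      ∀ (D : Problem m n d), D.Regular → D.Lf ≤ D.Lbarf →
      ∀ (xs : Vec d), (∀ x, D.objective xs ≤ D.objective x) →
      ∀ (x₀ : Stacked m d),
      ∃ ε₀ : ℝ, 0 < ε₀ ∧
        ∀ (U V : Matrix (Fin m) (Fin m) ℝ) (κ : ℝ), 1 ≤ κ → MixingPair d U V κ →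
          κ ≤ D.kappaB →
          κ ≤ max (n * D.kappaB / D.kappaS) (n ^ 2 * D.kappaB / D.kappaS ^ 2) →
        ∀ (Ω : Type*) [MeasurableSpace Ω] (P : Measure Ω) [IsProbabilityMeasure P]
          (ξ : ℕ → Ω → Noise m n (accParams D κ).b), IsSampling D P ξ →
        ∀ ε : ℝ, 0 < ε → ε ≤ ε₀ →
          ∃ K : ℕ,
            (∀ ω, ((run D U V (accParams D κ) x₀ (fun k => ξ k ω) K).comm : ℝ) ≤
              C * Real.sqrt (D.kappaB * κ) * Real.log (1 / ε)) ∧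
            (∀ i,
              Integrable
                (fun ω => ((run D U V (accParams D κ) x₀ (fun k => ξ k ω) K).evals i : ℝ)) P ∧
              ∫ ω, ((run D U V (accParams D κ) x₀ (fun k => ξ k ω) K).evals i : ℝ) ∂P ≤
                C * (Real.sqrt (n * D.kappaS) + n) * Real.log (1 / ε)) ∧
            (∀ k, K ≤ k →
              Integrable
                (fun ω => sqNorm
                  ((run D U V (accParams D κ) x₀ (fun t => ξ t ω) k).z - fun _ => xs)) P ∧
              ∫ ω, sqNorm
                ((run D U V (accParams D κ) x₀ (fun t => ξ t ω) k).z - fun _ => xs) ∂P ≤ ε) := by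
  -- The expected cost is `n + 3 b K` with `K ≤ 121 R ℓ` and `b R ≤ 2 (√(n κ_s) + n)`: this gives 3
  -- · 121 · 2 = 726, plus one for the initial `n`.
  refine ⟨727, by norm_num, fun m n d hm hn hd D hD hLS xs hxs x₀ => ?_⟩
  set M := |initConst D xs x₀| + 1 with hM
  have hM1 : 1 ≤ M := by have := abs_nonneg (initConst D xs x₀); linarith
  have hM0 : 0 < M := one_pos.trans_le hM1
  -- This threshold gives both `log (1 / ε) ≥ 1`, which absorbs additive constants, and `ε M ≤ 1`.
  refine ⟨Real.exp (-1) / M, by positivity, ?_⟩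
  intro U V κ hκ1 hUV hκB hκmax Ω _ P _ ξ hξ ε hε hε₀
  have h : Range D κ := ⟨hD.mu_pos, hLS, hκ1, hκB, hκmax⟩
  have hp := h.admissible hn
  set p := accParams D κ with hp_def
  set ρ := p.θ₁ / (30 * κ) with hρ
  set ℓ := Real.log (1 / ε) with hℓ
  set R := Real.sqrt (D.kappaB * κ) with hR
  have hρ0 : 0 < ρ := div_pos hp.theta1_pos (by linarith)
  have hρR : 1 / ρ = 60 * R := h.inv_rate
  have hR1 : 1 ≤ R := h.one_le_sqrt
  have hεM : ε * M ≤ Real.exp (-1) := (le_div_iff₀ hM0).1 hε₀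
  have hlogε : ℓ = -Real.log ε := by rw [hℓ, one_div, Real.log_inv]
  have hℓ1 : 1 ≤ ℓ := by
    have h1 : ε ≤ Real.exp (-1) := by nlinarith
    have h2 := Real.log_le_log hε h1
    rw [Real.log_exp] at h2
    linarith
  have hexp : Real.exp (-ℓ) = ε := by rw [hlogε, neg_neg, Real.exp_log hε]
  -- The factor 2 reduces the contraction to `ε²`; the spare `ε` absorbs the initial constant `M`.
  set K := ⌈2 * ℓ / ρ⌉₊ with hK
  have hKle : (K : ℝ) ≤ 121 * R * ℓ := by
    have h1 : (K : ℝ) < 2 * ℓ / ρ + 1 := Nat.ceil_lt_add_one (by positivity)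
    have h2 : 2 * ℓ / ρ = 120 * R * ℓ := by
      rw [div_eq_mul_one_div, hρR]; ring
    nlinarith
  refine ⟨K, fun ω => ?_, fun i => ⟨?_, ?_⟩, fun k hk => ⟨?_, ?_⟩⟩
  · rw [run_comm]
    have : 0 ≤ R * ℓ := by positivity
    linarith
  · exact hξ.integrable_run U V x₀ K fun s => (s.evals i : ℝ)
  · rw [hξ.integral_evals hD hm hn hd]
    have h1 : p.b * R ≤ 2 * (Real.sqrt (n * D.kappaS) + n) := h.batchSize_mul_sqrt_le
    have h2 : (p.b : ℝ) * K ≤ p.b * (121 * R * ℓ) := by gcongr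
    have h3 := mul_le_mul_of_nonneg_right h1 (by linarith : 0 ≤ 363 * ℓ)
    have h4 : (n : ℝ) ≤ (Real.sqrt (n * D.kappaS) + n) * ℓ := by
      have h5 : (n : ℝ) ≤ Real.sqrt (n * D.kappaS) + n :=
        le_add_of_nonneg_left (Real.sqrt_nonneg _)
      have h6 : (0 : ℝ) ≤ n := Nat.cast_nonneg n
      nlinarith
    linarith
  · exact hξ.integrable_run U V x₀ k fun s => sqNorm (s.z - fun _ => xs)
  · refine (hξ.integral_sqNorm_le hD hm hn hd h hUV hxs x₀ k).trans ?_
    have h1 : (1 - ρ) ^ k ≤ ε ^ 2 := by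
      have h2 : (1 - ρ) ^ k ≤ Real.exp (-ρ) ^ k :=
        pow_le_pow_left₀ (by linarith [hp.rho_le])
          (by linarith [Real.add_one_le_exp (-ρ)]) k
      refine h2.trans ?_
      rw [← hexp, ← Real.exp_nat_mul, ← Real.exp_nat_mul, Real.exp_le_exp]
      have h3 : 2 * ℓ / ρ ≤ k := (Nat.le_ceil _).trans (by exact_mod_cast hk)
      rw [div_le_iff₀ hρ0] at h3
      push_cast
      linarith
    have h2 : initConst D xs x₀ ≤ M := by have := le_abs_self (initConst D xs x₀); linarith
    have h3 : 0 ≤ (1 - ρ) ^ k := pow_nonneg (by linarith [hp.rho_le]) k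
    have h4 : Real.exp (-1) ≤ 1 := Real.exp_le_one_iff.2 (by norm_num)
    calc (1 - ρ) ^ k * initConst D xs x₀ ≤ (1 - ρ) ^ k * M := by gcongr
      _ ≤ ε ^ 2 * M := by gcongr
      _ = ε * (ε * M) := by ring
      _ ≤ ε * 1 := by gcongr; linarith
      _ = ε := mul_one ε
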